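/- **Conventions.** Let $L$ be a purely relational language with equality, all of whose symbols have positive finite arity; let $R$ be an additional relation symbol of arity $k\ge 1$ and $z_1,\dots,z_k$ additional constants. A *base structure* is a finite non-empty structure over $L_R=L\cup\{R\}$; a *gadget* is a finite structure $G$ over $L_G=L\cup\{z_1,\dots,z_k\}$ with $z_1^G,\dots,z_k^G$ pairwise distinct. For a base structure $A$ and a gadget $G$, $A*G$ is the $L$-structure with vertex set $\big(V(A)\sqcup (R^A\times V(G))\big)/{\sim}$, where $\sim$ is the equivalence generated by $e_i\sim (e,z_i^G)$ for $e\in R^A$, $i\le k$, and in which a symbol $S\in L$ of arity $s$ is interpreted by $$\{([a_1],\dots,[a_s]) : a\in S^A\}\cup\{([(e,v_1)],\dots,[(e,v_s)]) : e\in R^A,\ v\in S^G\}.$$ A vertex of $A*G$ is *internal* if its class contains a vertex of $A$, and *external* otherwise; an external vertex $x$ equals $[(e,v)]$ for a unique $R$-edge $e=:\rho(x)$. For a formula $\varphi$ with $q$ free variables, the Stone pairing $\langle\varphi,M\rangle$ is the probability that a uniformly random $q$-tuple of vertices of the finite structure $M$ satisfies $\varphi$ (for $q=0$ it is $1$ or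 $0$ according to whether $M\models\varphi$). A formula is *local* (*constant-local*) if for some $r$ its satisfaction in finite structures depends only on the substructure induced by the $r$-neighbourhood, in the Gaifman graph, of its free variables (of its free variables and the constants), with these marked. $\mathrm{FO}^{loc}_q$ and $\mathrm{FO}^{cloc}_q$ are the sets of local, respectively constant-local, formulas with $q$ free variables. For a set $X$ of formulas, a sequence $(M_n)$ is $X$-convergent if $\langle\varphi,M_n\rangle$ converges for every $\varphi\in X$. The *profile* of a $p$-tuple $a$ from $A*G$ is the ordered partition $\pi=(I,E_1,\dots,E_t)$ of $\{1,\dots,p\}$, where $I$ is the set of indices $i$ with $a_i$ internal (possibly empty), and the non-empty blocks $E_1,\dots,E_t$, listed by ascending minimal elements, are the classes of the equivalence $\rho(a_i)=\rho(a_{i'})$ on the remaining indices. For sequences $(A_n)$ of base structures and $(G_n)$ of gadgets, a profile $\pi$ is *trivial* if the probability that a uniformly random $p$-tuple from $A_n*G_n$ has profile $\pi$ tends to $0$ as $n\to\infty$. For an $L_R$-formula $\varphi(b_1,\dots,b_p)$, where $b_i$ is a single variable if $i\in I$ and a $k$-tuple of variables if $i\notin I$, let $\langle\varphi|_\pi,A\rangle$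 be the probability that uniformly random $b_1,\dots,b_p$ from $A$ satisfy $\varphi$, conditioned on the following event: for all $i,i'\notin I$, $b_i\in R^A$, and $b_i=b_{i'}$ if and only if $i,i'$ lie in a common block $E_j$. (Convergence of $\langle\varphi|_\pi,A_n\rangle$ includes that this event has positive probability in $A_n$ for all large $n$.) **Theorem.** Fix $p\ge 1$. Let $(A_n)$ be a sequence of base structures and $(G_n)$ a sequence of gadgets such that 1. for every non-trivial profile $\pi=(I,E_1,\dots,E_t)$ of a $p$-tuple and every local $L_R$-formula $\varphi\in\mathrm{FO}^{loc}_{|I|+(p-|I|)k}$, the sequence $\langle\varphi|_\pi,A_n\rangle$ converges; 2. $(G_n)$ is $\mathrm{FO}^{cloc}_m$-convergent, where $m=\max\{|E_1| : \pi=(I,E_1,\dots,E_t)\text{ is a non-trivial profile of a }p\text{-tuple}\}$ (with $|E_1|=0$ if $t=0$); 3. the proportion of internal vertices in $A_n*G_n$ tends to a limit $c$; 4. if $p\ge 2$ and $c<1$, then $|R^{A_n}|$ tends to a limit in $\mathbb N\cup\{0,\infty\}$. Then the sequence $(A_n*G_n)$ is $\mathrm{FO}^{loc}_p$-convergent. 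-/

import Mathlib

open Filter Topology
open scoped FirstOrder

universe u v w

noncomputable section

namespace GadgetLim

/-! ### Neighbourhoods, local and constant-local formulas -/

/-- The Gaifman graph of a structure: two distinct vertices are adjacent iff some tuple of
some relation contains both of them. -/
def gaifman (L : FirstOrder.Language.{v, w}) (M : Type u) [L.Structure M] : SimpleGraph M where
  Adj x y := x ≠ y ∧ ∃ (n : ℕ) (S : L.Relations n) (t : Fin n → M),
    FirstOrder.Language.Structure.RelMap S t ∧ x ∈ Set.range t ∧ y ∈ Set.range t
  symm := ⟨fun _ _ h => ⟨h.1.symm, by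
    obtain ⟨n, S, t, h1, h2, h3⟩ := h.2
    exact ⟨n, S, t, h1, h3, h2⟩⟩⟩
  loopless := ⟨fun _ h => h.1 rfl⟩

/-- The `r`-neighbourhood of a set `X` of vertices: all vertices at Gaifman distance at most
`r` from some element of `X` (unreachable vertices have distance `⊤`). -/
def nbhd (L : FirstOrder.Language.{v, w}) {M : Type u} [L.Structure M] (r : ℕ) (X : Set M) : Set M :=
  {y | ∃ x ∈ X, (gaifman L M).edist x y ≤ r}

theorem subset_nbhd (L : FirstOrder.Language.{v, w}) {M : Type u} [L.Structure M] (r : ℕ) (X : Set M) :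
    X ⊆ nbhd L r X :=
  fun x hx => ⟨x, hx, by simp⟩

/-- The substructure induced by the `r`-neighbourhood of `X`. For a relational language, or for
relations and constants when `X` contains all constants, its vertex set is exactly `nbhd L r X`
(see `coe_nbhdSub` and `coe_nbhdSub_withConstants`). -/
def nbhdSub (L : FirstOrder.Language.{v, w}) {M : Type u} [L.Structure M] (r : ℕ) (X : Set M) :
    L.Substructure M :=
  FirstOrder.Language.Substructure.closure L (nbhd L r X)

theorem mem_nbhdSub (L : FirstOrder.Language.{v, w}) {M : Type u} [L.Structure M] (r : ℕ) {X : Set M}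
    {x : M} (hx : x ∈ X) : x ∈ nbhdSub L r X :=
  FirstOrder.Language.Substructure.subset_closure (subset_nbhd L r X hx)

/-- The set of (values of) constants of a structure. -/
def constSet (L : FirstOrder.Language.{v, w}) (M : Type u) [L.Structure M] : Set M :=
  Set.range (fun c : L.Constants => (c : M))

theorem coe_nbhdSub (L : FirstOrder.Language.{v, w}) [L.IsRelational] {M : Type u} [L.Structure M] (r : ℕ)
    (X : Set M) : (nbhdSub L r X : Set M) = nbhd L r X :=
  FirstOrder.Language.Substructure.closure_eq_of_isRelational L _

theorem coe_nbhdSub_withConstants (L : FirstOrder.Language.{v, w}) [L.IsRelational] (k : ℕ) {M : Type u}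
    [L[[Fin k]].Structure M] (r : ℕ) (X : Set M) (hX : constSet L[[Fin k]] M ⊆ X) :
    (nbhdSub L[[Fin k]] r X : Set M) = nbhd L[[Fin k]] r X := by
  apply Set.Subset.antisymm _ FirstOrder.Language.Substructure.subset_closure
  let T : L[[Fin k]].Substructure M :=
    { carrier := nbhd L[[Fin k]] r X
      fun_mem := by
        intro n f x _
        cases n with
        | zero =>
          apply subset_nbhd
          apply hX
          exact ⟨f, (FirstOrder.Language.funMap_eq_coe_constants).symm⟩
        | succ n =>
          rcases f with f | f
          · exact isEmptyElim f
          · exact (IsEmpty.false f).elim }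
  exact (FirstOrder.Language.Substructure.closure_le (S := T)).2 (le_refl _)

/-- `φ` is `r`-local: on finite structures, its satisfaction depends only on the (isomorphism
type of the) substructure induced by the `r`-neighbourhood of the free variables, with the free
variables marked. Used for purely relational languages. -/
def IsLocalAt {L : FirstOrder.Language.{v, w}} {α : Type} (r : ℕ) (φ : L.Formula α) : Prop :=
  ∀ (M N : Type u) [L.Structure M] [L.Structure N] [Finite M] [Finite N]
    (a : α → M) (b : α → N)
    (e : nbhdSub L r (Set.range a) ≃[L] nbhdSub L r (Set.range b)),
    (∀ i, e ⟨a i, mem_nbhdSub L r ⟨i, rfl⟩⟩ = ⟨b i, mem_nbhdSub L r ⟨i, rfl⟩⟩) →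
      (φ.Realize a ↔ φ.Realize b)

/-- Local formulas. -/
def IsLocal {L : FirstOrder.Language.{v, w}} {α : Type} (φ : L.Formula α) : Prop :=
  ∃ r : ℕ, IsLocalAt.{u} r φ

/-- `φ` is `r`-constant-local: on finite structures, its satisfaction depends only on the
substructure induced by the `r`-neighbourhood of the free variables and the constants, with the
free variables and the constants marked. -/
def IsConstLocalAt {L : FirstOrder.Language.{v, w}} {α : Type} (r : ℕ) (φ : L.Formula α) : Prop :=
  ∀ (M N : Type u) [L.Structure M] [L.Structure N] [Finite M] [Finite N]
    (a : α → M) (b : α → N)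
    (e : nbhdSub L r (Set.range a ∪ constSet L M) ≃[L] nbhdSub L r (Set.range b ∪ constSet L N)),
    (∀ i, e ⟨a i, mem_nbhdSub L r (Or.inl ⟨i, rfl⟩)⟩ =
      ⟨b i, mem_nbhdSub L r (Or.inl ⟨i, rfl⟩)⟩) →
      (φ.Realize a ↔ φ.Realize b)

/-- Constant-local formulas. -/
def IsConstLocal {L : FirstOrder.Language.{v, w}} {α : Type} (φ : L.Formula α) : Prop :=
  ∃ r : ℕ, IsConstLocalAt.{u} r φ

/-! ### Stone pairings and convergence -/

/-- The Stone pairing of `φ` and a finite structure `M`: the probability that a uniformly chosen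
tuple of vertices satisfies `φ`. For a sentence (`α` empty) it is `1` or `0` according to whether
`M` satisfies `φ`. -/
def stonePairing {L : FirstOrder.Language.{v, w}} {α : Type} (φ : L.Formula α) (M : Type u)
    [L.Structure M] : ℝ :=
  (Nat.card {a : α → M // φ.Realize a} : ℝ) / Nat.card (α → M)

/-- Convergence of a sequence of reals to some real limit. -/
def Converges (x : ℕ → ℝ) : Prop := ∃ l : ℝ, Tendsto x atTop (𝓝 l)

/-- Convergence of the Stone pairings with all local formulas in `p` free variables. -/
def LocConvergent (L : FirstOrder.Language.{v, w}) (p : ℕ) (M : ℕ → Type u) [∀ n, L.Structure (M n)] :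
    Prop :=
  ∀ φ : L.Formula (Fin p), IsLocal.{u} φ → Converges fun n => stonePairing φ (M n)

/-- Convergence of the Stone pairings with all constant-local formulas in `p` free variables. -/
def CLocConvergent (L : FirstOrder.Language.{v, w}) (p : ℕ) (M : ℕ → Type u) [∀ n, L.Structure (M n)] :
    Prop :=
  ∀ φ : L.Formula (Fin p), IsConstLocal.{u} φ → Converges fun n => stonePairing φ (M n)

/-! ### Gadget construction -/

/-- The single relation symbol `R`, of arity `k`. -/
inductive EdgeSym (k : ℕ) : ℕ → Type
  | R : EdgeSym k k

/-- The language with the single `k`-ary relation symbol `R`. -/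
def edgeLang (k : ℕ) : FirstOrder.Language.{0, 0} := ⟨fun _ => Empty, EdgeSym k⟩

instance (k : ℕ) : (edgeLang k).IsRelational := fun _ => inferInstanceAs (IsEmpty Empty)

/-- The language `L_R` of base structures: `L` extended by the `k`-ary symbol `R`. -/
abbrev baseLang (L : FirstOrder.Language.{v, w}) (k : ℕ) : FirstOrder.Language.{v, w} := L.sum (edgeLang k)

/-- The language `L_G` of gadgets: `L` extended by `k` constants `z_1, ..., z_k`. -/
abbrev gadgetLang (L : FirstOrder.Language.{v, w}) (k : ℕ) : FirstOrder.Language.{v, w} := L[[Fin k]]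

section construction

variable (L : FirstOrder.Language.{v, w}) (k : ℕ)

/-- The set of `R`-edges of a base structure. -/
def edges (A : Type u) [(baseLang L k).Structure A] : Set (Fin k → A) :=
  {e | FirstOrder.Language.Structure.RelMap (L := baseLang L k) (Sum.inr EdgeSym.R) e}

/-- The roots `z_i` of a gadget. -/
def root (G : Type u) [(gadgetLang L k).Structure G] (i : Fin k) : G :=
  ((L.con i : (gadgetLang L k).Constants) : G)

variable (A G : Type u) [(baseLang L k).Structure A] [(gadgetLang L k).Structure G]

/-- The pairs `(a, (e, z_i))` with `a = e_i`, which generate the identification of vertices. -/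
inductive Glue : A ⊕ (edges L k A × G) → A ⊕ (edges L k A × G) → Prop
  | glue (e : edges L k A) (i : Fin k) : Glue (Sum.inl (e.1 i)) (Sum.inr (e, root L k G i))

/-- The vertex set of `A * G`: the quotient of `V(A) ∪ (R^A × V(G))` by the equivalence relation
generated by `Glue`. -/
def GadgetProd : Type u := Quot (Glue L k A G)

variable {A G}

/-- The class `[a]` in `A * G` of a vertex `a` of `A`. -/
def ofBase (a : A) : GadgetProd L k A G := Quot.mk _ (Sum.inl a)

/-- The class `[(e, x)]` in `A * G` of the vertex `x` in the copy of `G` placed on the `R`-edge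
`e`. -/
def ofCopy (e : edges L k A) (x : G) : GadgetProd L k A G := Quot.mk _ (Sum.inr (e, x))

variable (A G)

/-- The `L`-structure `A * G`: the tuples of a symbol `S` of `L` are the images of those of `A`
and the images of those in each copy of `G`. -/
instance [L.IsRelational] : L.Structure (GadgetProd L k A G) where
  funMap f := isEmptyElim f
  RelMap {s} S t :=
    (∃ a : Fin s → A, FirstOrder.Language.Structure.RelMap (L := baseLang L k) (Sum.inl S) a ∧
      t = fun j => ofBase L k (a j)) ∨
    (∃ (e : edges L k A) (x : Fin s → G),
      FirstOrder.Language.Structure.RelMap (L := gadgetLang L k) (Sum.inl S) x ∧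
      t = fun j => ofCopy L k e (x j))

variable {A G}

/-- A vertex of `A * G` is internal if its class contains a vertex of `A`, otherwise external. -/
def IsInternal (y : GadgetProd L k A G) : Prop := ∃ a : A, y = ofBase L k a

/-- `y` lies in the copy of `G` on the `R`-edge `e`. For external `y` there is exactly one such
`e`, denoted `ρ(y)`. -/
def InCopy (y : GadgetProd L k A G) (e : edges L k A) : Prop := ∃ x : G, y = ofCopy L k e x

variable (A G)

/-- The proportion of internal vertices in `A * G`. -/
def internalProportion : ℝ :=
  (Nat.card {y : GadgetProd L k A G // IsInternal L k y} : ℝ) / Nat.card (GadgetProd L k A G)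

end construction

/-! ### Profiles -/

/-- A profile of a `p`-tuple: a set `I` of indices and a partition of the remaining indices into
nonempty blocks. The listing `E_1, ..., E_t` of the blocks by ascending minimal elements is
determined by the partition. -/
structure Profile (p : ℕ) where
  I : Finset (Fin p)
  blocks : Finpartition Iᶜ

/-- `i` and `j` lie in a common block. -/
def Profile.SameBlock {p : ℕ} (π : Profile p) (i j : Fin p) : Prop :=
  ∃ E ∈ π.blocks.parts, i ∈ E ∧ j ∈ E

/-- `|E_1|`, the size of the block that contains the least index outside `I`; it is `0` if there
are no blocks. -/
def Profile.firstBlockCard {p : ℕ} (π : Profile p) : ℕ :=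
  if h : (π.I)ᶜ.Nonempty then (π.blocks.part ((π.I)ᶜ.min' h)).card else 0

/-- The tuple `a` of vertices of `A * G` has profile `π`: the internal vertices are those with
index in `I`, and two external vertices `a i`, `a j` have `ρ(a i) = ρ(a j)` iff `i` and `j` lie
in the same block. -/
def HasProfile (L : FirstOrder.Language.{v, w}) (k : ℕ) {A G : Type u} [(baseLang L k).Structure A]
    [(gadgetLang L k).Structure G] {p : ℕ} (π : Profile p) (a : Fin p → GadgetProd L k A G) : Prop :=
  (∀ i, i ∈ π.I ↔ IsInternal L k (a i)) ∧
  ∀ i j, i ∉ π.I → j ∉ π.I →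
    ((∃ e, InCopy L k (a i) e ∧ InCopy L k (a j) e) ↔ π.SameBlock i j)

/-- The probability that a uniformly random `p`-tuple from `A * G` has profile `π`. -/
def profileProb (L : FirstOrder.Language.{v, w}) (k : ℕ) {p : ℕ} (π : Profile p) (A G : Type u)
    [(baseLang L k).Structure A] [(gadgetLang L k).Structure G] : ℝ :=
  (Nat.card {a : Fin p → GadgetProd L k A G // HasProfile L k π a} : ℝ) /
    Nat.card (Fin p → GadgetProd L k A G)

/-- `π` is trivial with respect to the sequence `A n * G n`: the probability that a random
`p`-tuple has profile `π` tends to `0`. -/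
def IsTrivialProfile (L : FirstOrder.Language.{v, w}) (k : ℕ) {p : ℕ} (π : Profile p) (A G : ℕ → Type u)
    [∀ n, (baseLang L k).Structure (A n)] [∀ n, (gadgetLang L k).Structure (G n)] : Prop :=
  Tendsto (fun n => profileProb L k π (A n) (G n)) atTop (𝓝 0)

/-- The `|I| + (p - |I|) k` variables of a representation: one variable `b_i` for every `i ∈ I`
and a block `b_i` of `k` variables for every `i ∉ I`. -/
abbrev RepVar (k : ℕ) {p : ℕ} (π : Profile p) : Type :=
  {i : Fin p // i ∈ π.I} ⊕ ({i : Fin p // i ∉ π.I} × Fin k)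

/-- The block `b_i`, `i ∉ I`, of an assignment `b`. -/
def edgeBlock {k : ℕ} {p : ℕ} {π : Profile p} {A : Type u} (b : RepVar k π → A)
    (i : {i : Fin p // i ∉ π.I}) : Fin k → A :=
  fun j => b (Sum.inr (i, j))

/-- The condition in the conditional Stone pairing: for all `i, j ∉ I`, the tuple `b_i` is an
`R`-edge, and `b_i = b_j` iff `i` and `j` lie in the same block. -/
def IsRep (L : FirstOrder.Language.{v, w}) (k : ℕ) {p : ℕ} (π : Profile p) {A : Type u}
    [(baseLang L k).Structure A] (b : RepVar k π → A) : Prop :=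
  ∀ i : {i : Fin p // i ∉ π.I}, edgeBlock b i ∈ edges L k A ∧
    ∀ j : {i : Fin p // i ∉ π.I}, edgeBlock b i = edgeBlock b j ↔ π.SameBlock i.1 j.1

/-- The conditional Stone pairing of `φ` and `A` given the profile `π`: the probability that a
uniformly random assignment satisfies `φ`, given that it satisfies `IsRep`. (It is `0` where the
condition has probability `0`; so if, for the true formula, the values converge to a limit and do
not vanish eventually, then the condition has positive probability for all large `n`.) -/
def condStonePairing (L : FirstOrder.Language.{v, w}) (k : ℕ) {p : ℕ} (π : Profile p)
    (φ : (baseLang L k).Formula (RepVar k π)) (A : Type u) [(baseLang L k).Structure A] : ℝ :=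
  (Nat.card {b : RepVar k π → A // IsRep L k π b ∧ φ.Realize b} : ℝ) /
    Nat.card {b : RepVar k π → A // IsRep L k π b}

end GadgetLim

end

/-! A random `p`-tuple of `A * G` is split by its profile. There are finitely many profiles and the
trivial ones contribute nothing in the limit, so one non-trivial profile `π` can be treated at a
time. Let it have `s` external indices in `t` blocks. By `profileEquiv`, a tuple with profile `π`
amounts to a representation `b` in `A` (a vertex for each internal index, distinct `R`-edges for the
blocks) together with arbitrary non-root vertices of `G` for the external indices. Hence, given `π`,
the base part and the gadget parts of the separate blocks are independent. The probability of `π` is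
`x ^ |I| * (1 - x) ^ s` times `N (N - 1) ⋯ (N - t + 1) / N ^ s`, where `x` is the proportion of
internal vertices and `N` the number of `R`-edges; this converges (`converges_profileProb`).

It remains to read off the truth of a local formula from these parts, which is a Feferman–Vaught
argument. Locality permits cutting `A` down to a ball around `b`, and each copy of `G` down to a
ball around its roots and listed vertices (`realize_iff_realize_domainSub`). On the cut structures
an Ehrenfeucht–Fraïssé game is played componentwise (`determinesRank`): a move in the base is
answered in the base, a move in the copy on a named edge is answered in the matching copy, and a
move in any other copy costs `k` base moves to name its edge and one move in the gadget. So the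
types of bounded rank of `b`, of each block with the roots, and of the roots alone decide the
formula (`realize_profileTuple_iff`).

A formula uses a finite set `S` of symbols, so only finitely many types occur, and each is expressed
by a local or constant-local formula. For this, balls are taken with respect to `S`, because the
Gaifman graph of an infinite language need not be definable. The probability in question is thus a
finite sum of products of convergent densities (`converges_profile_part`). Two points need care. The
gadgets converge only for `m` variables, but permuting indices shows that every block of a
non-trivial profile has size at most `m`. The gadget densities are conditioned on avoiding the
roots, which is harmless because non-roots, where they exist, have proportion at least `1 / (k +
1)`. -/

noncomputable section

namespace GadgetLim

open FirstOrder FirstOrder.Language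

/-! ### Rank types -/

section RankType

variable {L : FirstOrder.Language.{v, w}} (S : Set (Σ n, L.Relations n))

/-- Atomic types, over the symbols in `S`, of tuples indexed by `α`. -/
def AtomType (α : Type) : Type w := Set (α × α) × Set (Σ R : S, (Fin R.1.1 → α))

/-- Types of quantifier rank `q`, over the symbols in `S`, of tuples indexed by `α`. -/
def RankType : ℕ → Type → Type w
  | 0, α => AtomType S α
  | q + 1, α => AtomType S α × Set (RankType q (α ⊕ Unit))

/-- The tuple `x` extended by one element `y`. -/
def extend {α M : Type*} (x : α → M) (y : M) : α ⊕ Unit → M := Sum.elim x fun _ => y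

/-- The atomic type of a tuple. -/
def atomType {M : Type u} [L.Structure M] {α : Type} (x : α → M) : AtomType S α :=
  ({ij | x ij.1 = x ij.2}, {Ri | Structure.RelMap Ri.1.1.2 (x ∘ Ri.2)})

/-- The type of quantifier rank `q` of a tuple, all quantifiers being restricted to `U`. -/
def rankType {M : Type u} [L.Structure M] (U : Set M) : (q : ℕ) → {α : Type} → (α → M) → RankType S q α
  | 0, _, x => atomType S x
  | q + 1, _, x => (atomType S x, {τ | ∃ y ∈ U, rankType U q (extend x y) = τ})

/-- This finiteness turns a property decided by types into a finite disjunction, hence a probability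
into a finite sum. -/
instance (q : ℕ) (α : Type) [Finite α] [Finite S] : Finite (RankType S q α) := by
  induction q generalizing α with
  | zero => unfold RankType AtomType; infer_instance
  | succ q ih => unfold RankType AtomType; infer_instance

variable {S} {M N : Type u} [L.Structure M] [L.Structure N]

theorem rankType_zero_iff {U : Set M} {V : Set N} {α : Type} {x : α → M} {y : α → N} :
    rankType S U 0 x = rankType S V 0 y ↔ (∀ i j, x i = x j ↔ y i = y j) ∧
      ∀ (n : ℕ) (R : L.Relations n), ⟨n, R⟩ ∈ S → ∀ t : Fin n → α,
        (Structure.RelMap R (x ∘ t) ↔ Structure.RelMap R (y ∘ t)) := by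
  simp only [rankType, atomType]
  refine Prod.ext_iff.trans (and_congr ?_ ?_)
  · simp [Set.ext_iff]
  · simp only [Set.ext_iff]
    exact ⟨fun h n R hR t => h ⟨⟨⟨n, R⟩, hR⟩, t⟩, fun h Ri => h _ _ Ri.1.2 _⟩

/-- One round of the Ehrenfeucht–Fraïssé game with moves confined to `U` and `V`. Types of two
structures are compared in this form. -/
theorem rankType_succ_iff {U : Set M} {V : Set N} {q : ℕ} {α : Type} {x : α → M} {y : α → N} :
    rankType S U (q + 1) x = rankType S V (q + 1) y ↔ rankType S U 0 x = rankType S V 0 y ∧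
      (∀ a ∈ U, ∃ b ∈ V, rankType S U q (extend x a) = rankType S V q (extend y b)) ∧
      ∀ b ∈ V, ∃ a ∈ U, rankType S U q (extend x a) = rankType S V q (extend y b) := by
  refine Prod.ext_iff.trans (and_congr Iff.rfl ?_)
  constructor
  · intro h
    have h : {τ | ∃ a ∈ U, rankType S U q (extend x a) = τ} =
      {τ | ∃ b ∈ V, rankType S V q (extend y b) = τ} := h
    refine ⟨fun a ha => ?_, fun b hb => ?_⟩
    · obtain ⟨b, hb, e⟩ := (Set.ext_iff.1 h (rankType S U q (extend x a))).1 ⟨a, ha, rfl⟩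
      exact ⟨b, hb, e.symm⟩
    · obtain ⟨a, ha, e⟩ := (Set.ext_iff.1 h (rankType S V q (extend y b))).2 ⟨b, hb, rfl⟩
      exact ⟨a, ha, e⟩
  · rintro ⟨h1, h2⟩
    ext τ
    constructor
    · rintro ⟨a, ha, rfl⟩
      obtain ⟨b, hb, e⟩ := h1 a ha
      exact ⟨b, hb, e.symm⟩
    · rintro ⟨b, hb, rfl⟩
      obtain ⟨a, ha, e⟩ := h2 b hb
      exact ⟨a, ha, e⟩

theorem extend_comp {α β X : Type*} (x : α → X) (f : β → α) (y : X) :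
    extend (x ∘ f) y = extend x y ∘ Sum.map f id := by
  ext i
  rcases i with i | i <;> rfl

theorem comp_extend {α X Y : Type*} (f : X → Y) (x : α → X) (y : X) :
    f ∘ extend x y = extend (f ∘ x) (f y) := by
  ext i
  rcases i with i | i <;> rfl

/-- The reindexing that relates the extension of a tuple with `Fin.snoc` and with `extend`. -/
def snocIndex (α : Type) (n : ℕ) : α ⊕ Fin (n + 1) → (α ⊕ Fin n) ⊕ Unit :=
  Sum.elim (fun i => Sum.inl (Sum.inl i)) (Fin.lastCases (Sum.inr ()) fun i => Sum.inl (Sum.inr i))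

theorem elim_snoc {α : Type} {X : Type*} {n : ℕ} (x : α → X) (xs : Fin n → X) (a : X) :
    Sum.elim x (Fin.snoc xs a : Fin (n + 1) → X) = extend (Sum.elim x xs) a ∘ snocIndex α n := by
  ext i
  rcases i with i | i
  · rfl
  · refine Fin.lastCases ?_ (fun i => ?_) i <;> simp [extend, snocIndex]

/-- The type of a tuple determines the types of its reindexings. -/
theorem rankType_reindex {U : Set M} {V : Set N} {q : ℕ} {α β : Type} {x : α → M} {y : α → N}
    (h : rankType S U q x = rankType S V q y) (f : β → α) :
    rankType S U q (x ∘ f) = rankType S V q (y ∘ f) := by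
  have key : ∀ {α β : Type} {x : α → M} {y : α → N} (f : β → α),
      rankType S U 0 x = rankType S V 0 y → rankType S U 0 (x ∘ f) = rankType S V 0 (y ∘ f) := by
    intro α β x y f h
    rw [rankType_zero_iff] at h ⊢
    exact ⟨fun i j => h.1 _ _, fun n R hR t => h.2 n R hR (f ∘ t)⟩
  induction q generalizing α β with
  | zero => exact key f h
  | succ q ih =>
    rw [rankType_succ_iff] at h ⊢
    refine ⟨key f h.1, fun a ha => ?_, fun b hb => ?_⟩
    · obtain ⟨b, hb, e⟩ := h.2.1 a ha
      refine ⟨b, hb, ?_⟩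
      rw [extend_comp, extend_comp]
      exact ih e _
    · obtain ⟨a, ha, e⟩ := h.2.2 b hb
      refine ⟨a, ha, ?_⟩
      rw [extend_comp, extend_comp]
      exact ih e _

theorem rankType_of_succ {U : Set M} {V : Set N} {q : ℕ} {α : Type} {x : α → M} {y : α → N}
    (h : rankType S U (q + 1) x = rankType S V (q + 1) y) :
    rankType S U q x = rankType S V q y := by
  induction q generalizing α with
  | zero => exact (rankType_succ_iff.1 h).1
  | succ q ih =>
    rw [rankType_succ_iff] at h ⊢
    refine ⟨h.1, fun a ha => ?_, fun b hb => ?_⟩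
    · obtain ⟨b, hb, e⟩ := h.2.1 a ha
      exact ⟨b, hb, ih e⟩
    · obtain ⟨a, ha, e⟩ := h.2.2 b hb
      exact ⟨a, ha, ih e⟩

theorem rankType_of_le {U : Set M} {V : Set N} {q q' : ℕ} (hq : q ≤ q') {α : Type} {x : α → M}
    {y : α → N} (h : rankType S U q' x = rankType S V q' y) :
    rankType S U q x = rankType S V q y := by
  induction q', hq using Nat.le_induction with
  | base => exact h
  | succ q' _ ih => exact ih (rankType_of_succ h)

theorem rankType_of_subset {S' : Set (Σ n, L.Relations n)} (hS : S' ⊆ S) {U : Set M} {V : Set N}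
    {q : ℕ} {α : Type} {x : α → M} {y : α → N} (h : rankType S U q x = rankType S V q y) :
    rankType S' U q x = rankType S' V q y := by
  have key : ∀ {α : Type} {x : α → M} {y : α → N},
      rankType S U 0 x = rankType S V 0 y → rankType S' U 0 x = rankType S' V 0 y := by
    intro α x y h
    rw [rankType_zero_iff] at h ⊢
    exact ⟨h.1, fun n R hR t => h.2 n R (hS hR) t⟩
  induction q generalizing α with
  | zero => exact key h
  | succ q ih =>
    rw [rankType_succ_iff] at h ⊢
    refine ⟨key h.1, fun a ha => ?_, fun b hb => ?_⟩
    · obtain ⟨b, hb, e⟩ := h.2.1 a ha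
      exact ⟨b, hb, ih e⟩
    · obtain ⟨a, ha, e⟩ := h.2.2 b hb
      exact ⟨a, ha, ih e⟩

/-- Types are preserved by injective maps that preserve and reflect the relations. -/
theorem rankType_map (f : M → N) (hf : Function.Injective f)
    (hrel : ∀ (n : ℕ) (R : L.Relations n), ⟨n, R⟩ ∈ S → ∀ t : Fin n → M,
      (Structure.RelMap R (f ∘ t) ↔ Structure.RelMap R t))
    (U : Set M) (q : ℕ) {α : Type} (x : α → M) :
    rankType S U q x = rankType S (f '' U) q (f ∘ x) := by
  have key : ∀ {α : Type} (x : α → M), rankType S U 0 x = rankType S (f '' U) 0 (f ∘ x) := by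
    intro α x
    rw [rankType_zero_iff]
    exact ⟨fun i j => hf.eq_iff.symm, fun n R hR t => (hrel n R hR _).symm⟩
  induction q generalizing α with
  | zero => exact key x
  | succ q ih =>
    rw [rankType_succ_iff]
    refine ⟨key x, fun a ha => ⟨f a, ⟨a, ha, rfl⟩, ?_⟩, ?_⟩
    · rw [← comp_extend]; exact ih _
    · rintro _ ⟨a, ha, rfl⟩
      refine ⟨a, ha, ?_⟩
      rw [← comp_extend]; exact ih _

/-- Iterating the forth condition: `m` moves are answered in succession, each lowering the rank by
one. -/
theorem rankType_add {U : Set M} {V : Set N} {q m : ℕ} {α : Type} {x : α → M} {y : α → N}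
    (h : rankType S U (q + m) x = rankType S V (q + m) y) (c : Fin m → M) (hc : ∀ i, c i ∈ U) :
    ∃ d : Fin m → N, (∀ i, d i ∈ V) ∧
      rankType S U q (Sum.elim x c) = rankType S V q (Sum.elim y d) := by
  induction m generalizing q with
  | zero =>
    refine ⟨Fin.elim0, fun i => i.elim0, ?_⟩
    have : ∀ {X : Type u} (x : α → X) (c : Fin 0 → X), Sum.elim x c =
        x ∘ (Sum.elim id (fun i : Fin 0 => i.elim0) : α ⊕ Fin 0 → α) := by
      intro X x c
      ext i
      rcases i with i | i
      · rfl
      · exact i.elim0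
    rw [this, this]
    exact rankType_reindex h _
  | succ m ih =>
    obtain ⟨d, hd, e⟩ := ih (q := q + 1) (by rw [show q + 1 + m = q + (m + 1) by omega]; exact h)
      (Fin.init c) (fun i => hc _)
    obtain ⟨b, hb, e⟩ := (rankType_succ_iff.1 e).2.1 (c (Fin.last m)) (hc _)
    refine ⟨Fin.snoc d b, fun i => ?_, ?_⟩
    · refine Fin.lastCases ?_ (fun i => ?_) i
      · simpa using hb
      · simpa using hd i
    · rw [← Fin.snoc_init_self c, elim_snoc, elim_snoc]
      exact rankType_reindex e _

end RankType

/-! ### Types determine the truth of formulas -/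

theorem term_eq_var {L : FirstOrder.Language.{v, w}} [L.IsRelational] {α : Type} (t : L.Term α) :
    ∃ i, t = Term.var i := by
  cases t with
  | var i => exact ⟨i, rfl⟩
  | func f _ => exact isEmptyElim f

/-- `S` collects the symbols of the formula and `q` bounds its quantifier depth. In a relational
language every term is a variable, so atomic formulas are decided by atomic types. -/
theorem exists_rankType_realize {L : FirstOrder.Language.{v, w}} [L.IsRelational] {α : Type} {n : ℕ}
    (φ : L.BoundedFormula α n) : ∃ (S : Set (Σ n, L.Relations n)) (q : ℕ), S.Finite ∧
      ∀ (M N : Type u) [L.Structure M] [L.Structure N] (x : α → M) (xs : Fin n → M) (y : α → N)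
        (ys : Fin n → N), rankType S Set.univ q (Sum.elim x xs) =
          rankType S Set.univ q (Sum.elim y ys) → (φ.Realize x xs ↔ φ.Realize y ys) := by
  induction φ with
  | falsum => exact ⟨∅, 0, Set.finite_empty, fun _ _ _ _ _ _ _ _ _ => Iff.rfl⟩
  | equal t₁ t₂ =>
    refine ⟨∅, 0, Set.finite_empty, fun M N _ _ x xs y ys h => ?_⟩
    obtain ⟨i, rfl⟩ := term_eq_var t₁
    obtain ⟨j, rfl⟩ := term_eq_var t₂
    exact (rankType_zero_iff.1 h).1 i j
  | @rel n l R ts =>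
    refine ⟨{⟨l, R⟩}, 0, Set.finite_singleton _, fun M N _ _ x xs y ys h => ?_⟩
    choose i hi using fun j => term_eq_var (ts j)
    obtain rfl : ts = fun j => Term.var (i j) := funext hi
    exact (rankType_zero_iff.1 h).2 l R rfl i
  | imp φ₁ φ₂ ih₁ ih₂ =>
    obtain ⟨S₁, q₁, hS₁, h₁⟩ := ih₁
    obtain ⟨S₂, q₂, hS₂, h₂⟩ := ih₂
    refine ⟨S₁ ∪ S₂, max q₁ q₂, hS₁.union hS₂, fun M N _ _ x xs y ys h => ?_⟩
    rw [BoundedFormula.realize_imp, BoundedFormula.realize_imp,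
      h₁ M N x xs y ys (rankType_of_subset Set.subset_union_left
        (rankType_of_le (le_max_left _ _) h)),
      h₂ M N x xs y ys (rankType_of_subset Set.subset_union_right
        (rankType_of_le (le_max_right _ _) h))]
  | @all n φ ih =>
    obtain ⟨S, q, hS, h⟩ := ih
    refine ⟨S, q + 1, hS, fun M N _ _ x xs y ys e => ?_⟩
    rw [rankType_succ_iff] at e
    rw [BoundedFormula.realize_all, BoundedFormula.realize_all]
    constructor
    · intro H b
      obtain ⟨a, -, e'⟩ := e.2.2 b trivial
      refine (h M N x _ y _ ?_).1 (H a)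
      rw [elim_snoc, elim_snoc]
      exact rankType_reindex e' _
    · intro H a
      obtain ⟨b, -, e'⟩ := e.2.1 a trivial
      refine (h M N x _ y _ ?_).2 (H b)
      rw [elim_snoc, elim_snoc]
      exact rankType_reindex e' _

theorem exists_rankType_formula_realize {L : FirstOrder.Language.{v, w}} [L.IsRelational] {α : Type}
    (φ : L.Formula α) : ∃ (S : Set (Σ n, L.Relations n)) (q : ℕ), S.Finite ∧
      ∀ (M N : Type u) [L.Structure M] [L.Structure N] (x : α → M) (y : α → N),
        rankType S Set.univ q x = rankType S Set.univ q y → (φ.Realize x ↔ φ.Realize y) := by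
  obtain ⟨S, q, hS, h⟩ := exists_rankType_realize.{u} φ
  refine ⟨S, q, hS, fun M N _ _ x y e => h M N x _ y _ ?_⟩
  have : ∀ (M : Type u) (x : α → M), Sum.elim x (default : Fin 0 → M) =
      x ∘ (Sum.elim id (fun i : Fin 0 => i.elim0) : α ⊕ Fin 0 → α) := by
    intro M x
    ext i
    rcases i with i | i
    · rfl
    · exact i.elim0
  rw [this, this]
  exact rankType_reindex e _

/-! ### Neighbourhoods with respect to a set of symbols -/

section SymbNbhd

variable {L : FirstOrder.Language.{v, w}} (S : Set (Σ n, L.Relations n))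
  {M : Type u} [L.Structure M]

/-- `x` and `y` are equal or lie in a common tuple of some symbol in `S`. -/
def Linked (x y : M) : Prop :=
  x = y ∨ ∃ R : S, ∃ t : Fin R.1.1 → M, Structure.RelMap R.1.2 t ∧
    (∃ i, t i = x) ∧ ∃ j, t j = y

/-- The `r`-neighbourhood of `X` with respect to the symbols in `S`. -/
def symbNbhd : ℕ → Set M → Set M
  | 0, X => X
  | r + 1, X => {y | ∃ x ∈ symbNbhd r X, Linked S x y}

variable {S}

theorem symbNbhd_subset_succ (r : ℕ) (X : Set M) : symbNbhd S r X ⊆ symbNbhd S (r + 1) X :=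
  fun x hx => ⟨x, hx, Or.inl rfl⟩

theorem symbNbhd_mono {r r' : ℕ} (h : r ≤ r') (X : Set M) : symbNbhd S r X ⊆ symbNbhd S r' X := by
  induction r', h using Nat.le_induction with
  | base => exact le_rfl
  | succ r' _ ih => exact ih.trans (symbNbhd_subset_succ _ _)

theorem subset_symbNbhd (r : ℕ) (X : Set M) : X ⊆ symbNbhd S r X :=
  symbNbhd_mono (Nat.zero_le r) X

theorem mem_symbNbhd_succ_of_relMap {r : ℕ} {X : Set M} {n : ℕ} {R : L.Relations n}
    (hR : ⟨n, R⟩ ∈ S) {t : Fin n → M} (ht : Structure.RelMap R t) {i : Fin n}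
    (hi : t i ∈ symbNbhd S r X) (j : Fin n) : t j ∈ symbNbhd S (r + 1) X :=
  ⟨t i, hi, Or.inr ⟨⟨⟨n, R⟩, hR⟩, t, ht, ⟨i, rfl⟩, ⟨j, rfl⟩⟩⟩

theorem edist_le_one_of_linked {x y : M} (h : Linked S x y) : (gaifman L M).edist x y ≤ 1 := by
  rw [SimpleGraph.edist_le_one_iff_adj_or_eq]
  by_cases hxy : x = y
  · exact Or.inr hxy
  · rcases h with h | ⟨R, t, ht, hx, hy⟩
    · exact Or.inr h
    · exact Or.inl ⟨hxy, R.1.1, R.1.2, t, ht, hx, hy⟩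

theorem symbNbhd_subset_nbhd (r : ℕ) (X : Set M) : symbNbhd S r X ⊆ nbhd L r X := by
  induction r with
  | zero => exact subset_nbhd L 0 X
  | succ r ih =>
    rintro y ⟨x, hx, hxy⟩
    obtain ⟨z, hz, hzx⟩ := ih hx
    refine ⟨z, hz, (SimpleGraph.edist_triangle (v := x)).trans ?_⟩
    push_cast
    exact add_le_add hzx (edist_le_one_of_linked hxy)

theorem nbhd_mono {r r' : ℕ} (h : r ≤ r') (X : Set M) : nbhd L r X ⊆ nbhd L r' X := by
  rintro y ⟨x, hx, hxy⟩
  exact ⟨x, hx, hxy.trans (by exact_mod_cast h)⟩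

/-- If the symbols outside `S` are empty, then `symbNbhd` is the neighbourhood in the Gaifman
graph. -/
theorem nbhd_subset_symbNbhd (hS : ∀ (n : ℕ) (R : L.Relations n) (t : Fin n → M),
    Structure.RelMap R t → ⟨n, R⟩ ∈ S) (r : ℕ) (X : Set M) : nbhd L r X ⊆ symbNbhd S r X := by
  have key : ∀ {x y : M} (p : (gaifman L M).Walk x y), x ∈ X → y ∈ symbNbhd S p.length X := by
    intro x y p hx
    induction p using SimpleGraph.Walk.concatRec with
    | Hnil => exact hx
    | Hconcat p h ih =>
      rw [SimpleGraph.Walk.length_concat]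
      obtain ⟨-, n, R, t, ht, ⟨i, hi⟩, ⟨j, hj⟩⟩ := h
      exact ⟨_, ih hx, Or.inr ⟨⟨⟨n, R⟩, hS n R t ht⟩, t, ht, ⟨i, hi⟩, ⟨j, hj⟩⟩⟩
  rintro y ⟨x, hx, hxy⟩
  obtain ⟨p, hp⟩ := SimpleGraph.exists_walk_of_edist_ne_top
    (ne_top_of_le_ne_top (ENat.natCast_ne_top r) hxy)
  rw [← hp] at hxy
  exact symbNbhd_mono (by exact_mod_cast hxy) X (key p hx)

/-- All entries of the tuples along a chain of at most `r` links from `X` stay in the Gaifman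
`r`-ball of `X`, hence in `W`, where `e` preserves relations. The chain is therefore carried over
link by link. -/
theorem symbNbhd_equiv {N : Type u} [L.Structure N] {W : L.Substructure M} {W' : L.Substructure N}
    (e : W ≃[L] W') {X : Set M} {Y : Set N} {r : ℕ} (hX : nbhd L r X ⊆ W)
    (he : ∀ w : W, (w : M) ∈ X → (e w : N) ∈ Y) {i : ℕ} (hi : i ≤ r) (w : W)
    (hw : (w : M) ∈ symbNbhd S i X) : (e w : N) ∈ symbNbhd S i Y := by
  induction i generalizing w with
  | zero => exact he w hw
  | succ i ih =>
    have hsub : ∀ j ≤ r, symbNbhd S j X ⊆ W := fun j hj =>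
      (symbNbhd_subset_nbhd j X).trans ((nbhd_mono hj X).trans hX)
    obtain ⟨x, hx, hxw⟩ := hw
    have hxW := hsub i (by omega) hx
    rcases hxw with rfl | ⟨R, t, ht, ⟨a, rfl⟩, ⟨b, hb⟩⟩
    · exact symbNbhd_subset_succ _ _ (ih (by omega) w hx)
    · have htW : ∀ j, t j ∈ W := fun j =>
        hsub (i + 1) hi (mem_symbNbhd_succ_of_relMap R.2 ht hx j)
      have hrel : Structure.RelMap R.1.2 (fun j => (⟨t j, htW j⟩ : W)) := ht
      rw [← e.map_rel] at hrel
      have := mem_symbNbhd_succ_of_relMap (M := N) (X := Y) (r := i) R.2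
        (t := fun j => (e ⟨t j, htW j⟩ : N)) hrel (i := a) (ih (by omega) ⟨t a, htW a⟩ hx) b
      obtain rfl : ⟨t b, htW b⟩ = w := Subtype.ext hb
      exact this

/-- With quantifiers confined to the ball, a type never looks outside `W`. This makes the formulas
defining such types local. -/
theorem rankType_symbNbhd_eq_of_equiv {N : Type u} [L.Structure N] {W : L.Substructure M}
    {W' : L.Substructure N} (e : W ≃[L] W') {α : Type} {x : α → M} {y : α → N} {r : ℕ}
    (hx : nbhd L r (Set.range x) ⊆ W) (hy : nbhd L r (Set.range y) ⊆ W')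
    (hxW : ∀ i, x i ∈ W) (hyW : ∀ i, y i ∈ W') (he : ∀ i, e ⟨x i, hxW i⟩ = ⟨y i, hyW i⟩) (q : ℕ) :
    rankType S (symbNbhd S r (Set.range x)) q x = rankType S (symbNbhd S r (Set.range y)) q y := by
  have h1 : ∀ w : W, (w : M) ∈ Set.range x → (e w : N) ∈ Set.range y := by
    rintro w ⟨i, hi⟩
    obtain rfl : ⟨x i, hxW i⟩ = w := Subtype.ext hi
    exact ⟨i, by rw [he]⟩
  have h2 : ∀ w : W', (w : N) ∈ Set.range y → (e.symm w : M) ∈ Set.range x := by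
    rintro w ⟨i, hi⟩
    obtain rfl : ⟨y i, hyW i⟩ = w := Subtype.ext hi
    exact ⟨i, by rw [← he, FirstOrder.Language.Equiv.symm_apply_apply]⟩
  -- The type may be computed inside the substructure, since both the tuple and the range of the
  -- quantifiers lie in it.
  have key : ∀ {K : Type u} [L.Structure K] (V : L.Substructure K) (z : α → K)
      (hz : nbhd L r (Set.range z) ⊆ V) (hzV : ∀ i, z i ∈ V),
      rankType S (symbNbhd S r (Set.range z)) q z =
        rankType S ((↑) ⁻¹' symbNbhd S r (Set.range z) : Set V) q (fun i => (⟨z i, hzV i⟩ : V)) := by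
    intro K _ V z hz hzV
    rw [rankType_map (S := S) ((↑) : V → K) Subtype.val_injective (fun _ _ _ _ => Iff.rfl)]
    rw [Set.image_preimage_eq_of_subset]
    · rfl
    · rw [Subtype.range_coe]
      exact (symbNbhd_subset_nbhd _ _).trans hz
  rw [key W x hx hxW, key W' y hy hyW, rankType_map (S := S) e e.injective
    (fun n R _ t => e.map_rel R t)]
  congr 1
  · ext w
    constructor
    · rintro ⟨w, hw, rfl⟩
      exact symbNbhd_equiv e hx h1 le_rfl w hw
    · intro hw
      exact ⟨e.symm w, symbNbhd_equiv e.symm hy h2 le_rfl w hw, e.apply_symm_apply w⟩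
  · exact funext he

end SymbNbhd

/-! ### Definability of types -/

section Definability

variable {L : FirstOrder.Language.{v, w}} {α β : Type}

/-- A property of tuples in structures that is expressed by a formula. -/
def IsDefinable (P : ∀ (M : Type u) [L.Structure M], (α → M) → Prop) : Prop :=
  ∃ φ : L.Formula α, ∀ (M : Type u) [L.Structure M] (x : α → M), φ.Realize x ↔ P M x

variable {P Q : ∀ (M : Type u) [L.Structure M], (α → M) → Prop}

theorem IsDefinable.congr (hP : IsDefinable P)
    (h : ∀ (M : Type u) [L.Structure M] (x : α → M), P M x ↔ Q M x) : IsDefinable Q := by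
  obtain ⟨φ, hφ⟩ := hP
  exact ⟨φ, fun M _ x => (hφ M x).trans (h M x)⟩

theorem isDefinable_const (p : Prop) :
    IsDefinable (L := L) (α := α) fun (_ : Type u) _ _ => p := by
  by_cases hp : p
  · exact ⟨⊤, fun M _ x => by simp [hp]⟩
  · exact ⟨⊥, fun M _ x => by simp [hp]⟩

theorem IsDefinable.and (hP : IsDefinable P) (hQ : IsDefinable Q) :
    IsDefinable (L := L) fun (M : Type u) _ x => P M x ∧ Q M x := by
  obtain ⟨φ, hφ⟩ := hP
  obtain ⟨ψ, hψ⟩ := hQ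
  exact ⟨φ ⊓ ψ, fun M _ x => by rw [Formula.realize_inf, hφ, hψ]⟩

theorem IsDefinable.or (hP : IsDefinable P) (hQ : IsDefinable Q) :
    IsDefinable (L := L) fun (M : Type u) _ x => P M x ∨ Q M x := by
  obtain ⟨φ, hφ⟩ := hP
  obtain ⟨ψ, hψ⟩ := hQ
  exact ⟨φ ⊔ ψ, fun M _ x => by rw [Formula.realize_sup, hφ, hψ]⟩

theorem IsDefinable.iff (hP : IsDefinable P) (hQ : IsDefinable Q) :
    IsDefinable (L := L) fun (M : Type u) _ x => P M x ↔ Q M x := by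
  obtain ⟨φ, hφ⟩ := hP
  obtain ⟨ψ, hψ⟩ := hQ
  exact ⟨φ.iff ψ, fun M _ x => by rw [Formula.realize_iff, hφ, hψ]⟩

theorem isDefinable_forall {ι : Type*} [Finite ι]
    {P : ι → ∀ (M : Type u) [L.Structure M], (α → M) → Prop} (hP : ∀ i, IsDefinable (P i)) :
    IsDefinable (L := L) fun (M : Type u) _ x => ∀ i, P i M x := by
  choose φ hφ using hP
  exact ⟨Formula.iInf φ, fun M _ x => by simp only [Formula.realize_iInf, hφ]⟩

theorem isDefinable_exists {ι : Type*} [Finite ι]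
    {P : ι → ∀ (M : Type u) [L.Structure M], (α → M) → Prop} (hP : ∀ i, IsDefinable (P i)) :
    IsDefinable (L := L) fun (M : Type u) _ x => ∃ i, P i M x := by
  choose φ hφ using hP
  exact ⟨Formula.iSup φ, fun M _ x => by simp only [Formula.realize_iSup, hφ]⟩

theorem IsDefinable.subst (hP : IsDefinable P) (f : α → L.Term β) :
    IsDefinable (L := L) fun (M : Type u) _ (x : β → M) => P M (fun i => (f i).realize x) := by
  obtain ⟨φ, hφ⟩ := hP
  refine ⟨BoundedFormula.subst φ f, fun M _ x => ?_⟩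
  exact BoundedFormula.realize_subst.trans (hφ M _)

theorem isDefinable_exists_elim {P : ∀ (M : Type u) [L.Structure M], (α ⊕ β → M) → Prop} [Finite β]
    (hP : IsDefinable P) :
    IsDefinable (L := L) fun (M : Type u) _ (x : α → M) => ∃ y : β → M, P M (Sum.elim x y) := by
  obtain ⟨φ, hφ⟩ := hP
  exact ⟨φ.iExs β, fun M _ x => by simp only [Formula.realize_iExs, hφ]⟩

theorem isDefinable_exists_extend {P : ∀ (M : Type u) [L.Structure M], (α ⊕ Unit → M) → Prop}
    (hP : IsDefinable P) :
    IsDefinable (L := L) fun (M : Type u) _ (x : α → M) => ∃ y : M, P M (extend x y) :=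
  (isDefinable_exists_elim hP).congr fun _ _ _ =>
    ⟨fun ⟨y, hy⟩ => ⟨y (), hy⟩, fun ⟨y, hy⟩ => ⟨fun _ => y, hy⟩⟩

theorem isDefinable_eq (i j : α) : IsDefinable (L := L) fun (_ : Type u) _ x => x i = x j :=
  ⟨Term.equal (Term.var i) (Term.var j), fun M _ x => by simp⟩

theorem isDefinable_relMap {n : ℕ} (R : L.Relations n) (t : Fin n → α) :
    IsDefinable (L := L) fun (_ : Type u) _ x => Structure.RelMap R (x ∘ t) :=
  ⟨R.formula fun i => Term.var (t i), fun M _ x => by rw [Formula.realize_rel]; rfl⟩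

variable (S : Set (Σ n, L.Relations n)) [Finite S]

theorem isDefinable_linked (i j : α) :
    IsDefinable (L := L) fun (_ : Type u) _ x => Linked S (x i) (x j) := by
  refine (isDefinable_eq i j).or (isDefinable_exists fun R => ?_)
  have : IsDefinable (L := L) fun (M : Type u) _ (x : α → M) => ∃ t : Fin R.1.1 → M,
      Structure.RelMap R.1.2 (Sum.elim x t ∘ Sum.inr) ∧
        (∃ a, Sum.elim x t (Sum.inr a) = Sum.elim x t (Sum.inl i)) ∧
        (∃ b, Sum.elim x t (Sum.inr b) = Sum.elim x t (Sum.inl j)) :=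
    isDefinable_exists_elim (P := fun M _ x => Structure.RelMap R.1.2 (x ∘ Sum.inr) ∧
        (∃ a, x (Sum.inr a) = x (Sum.inl i)) ∧ (∃ b, x (Sum.inr b) = x (Sum.inl j)))
      ((isDefinable_relMap _ _).and ((isDefinable_exists fun _ => isDefinable_eq _ _).and
        (isDefinable_exists fun _ => isDefinable_eq _ _)))
  exact this

theorem isDefinable_mem_symbNbhd [Finite β] (r : ℕ) (f : β → α) (i : α) :
    IsDefinable (L := L) fun (_ : Type u) _ x => x i ∈ symbNbhd S r (Set.range (x ∘ f)) := by
  induction r generalizing α with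
  | zero => exact isDefinable_exists fun b => isDefinable_eq (f b) i
  | succ r ih =>
    exact isDefinable_exists_extend (P := fun M _ x => x (Sum.inr ()) ∈ symbNbhd S r
      (Set.range (x ∘ (Sum.inl ∘ f))) ∧ Linked S (x (Sum.inr ())) (x (Sum.inl i)))
      ((ih _ _).and (isDefinable_linked S _ _))

theorem isDefinable_atomType [Finite α] (τ : AtomType S α) :
    IsDefinable (L := L) fun (M : Type u) _ (x : α → M) => atomType (M := M) S x = τ := by
  have h1 : IsDefinable (L := L) fun (M : Type u) _ (x : α → M) =>
      ∀ ij : α × α, x ij.1 = x ij.2 ↔ ij ∈ τ.1 :=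
    isDefinable_forall fun ij => (isDefinable_eq _ _).iff (isDefinable_const _)
  have h2 : IsDefinable (L := L) fun (M : Type u) _ (x : α → M) =>
      ∀ Ri : Σ R : S, (Fin R.1.1 → α), Structure.RelMap Ri.1.1.2 (x ∘ Ri.2) ↔ Ri ∈ τ.2 :=
    isDefinable_forall fun Ri => (isDefinable_relMap _ _).iff (isDefinable_const _)
  refine (h1.and h2).congr fun M _ x => ?_
  exact (and_congr Set.ext_iff.symm Set.ext_iff.symm).trans
    (Prod.ext_iff (x := atomType S x) (y := τ)).symm

/-- The map `f` picks out the coordinates at the centre of the ball. It keeps the ball fixed while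
the induction appends quantified elements to the tuple. -/
theorem isDefinable_rankType [Finite α] [Finite β] (r q : ℕ) (f : β → α) (τ : RankType S q α) :
    IsDefinable (L := L) fun (M : Type u) _ (x : α → M) =>
      rankType S (symbNbhd S r (Set.range (x ∘ f))) q x = τ := by
  induction q generalizing α with
  | zero => exact isDefinable_atomType S τ
  | succ q ih =>
    have h1 : IsDefinable (L := L) fun (M : Type u) _ (x : α → M) =>
        ∀ σ : RankType S q (α ⊕ Unit), (∃ y ∈ symbNbhd S r (Set.range (x ∘ f)),
          rankType S (symbNbhd S r (Set.range (x ∘ f))) q (extend x y) = σ) ↔ σ ∈ τ.2 := by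
      refine isDefinable_forall fun σ => ?_
      refine IsDefinable.iff ?_ (isDefinable_const _)
      exact isDefinable_exists_extend (P := fun M _ x =>
        x (Sum.inr ()) ∈ symbNbhd S r (Set.range (x ∘ (Sum.inl ∘ f))) ∧
        rankType S (symbNbhd S r (Set.range (x ∘ (Sum.inl ∘ f)))) q x = σ)
        ((isDefinable_mem_symbNbhd S r _ _).and (ih _ σ))
    refine ((isDefinable_atomType S τ.1).and h1).congr fun M _ x => ?_
    exact (and_congr Iff.rfl Set.ext_iff.symm).trans
      (Prod.ext_iff (x := rankType S (symbNbhd S r (Set.range (x ∘ f))) (q + 1) x) (y := τ)).symm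

/-- A local formula that expresses the type of its free variables in their neighbourhood. -/
theorem exists_isLocal_rankType [Finite α] (r q : ℕ) (τ : RankType S q α) :
    ∃ φ : L.Formula α, IsLocal.{u} φ ∧ ∀ (M : Type u) [L.Structure M] (x : α → M),
      φ.Realize x ↔ rankType S (symbNbhd S r (Set.range x)) q x = τ := by
  obtain ⟨φ, hφ⟩ := isDefinable_rankType S r q id τ
  refine ⟨φ, ⟨r, fun M N _ _ _ _ a b e he => ?_⟩, hφ⟩
  rw [hφ, hφ]
  exact Eq.congr_left (rankType_symbNbhd_eq_of_equiv e Substructure.subset_closure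
    Substructure.subset_closure _ _ he q)

end Definability

/-! ### Constant-local formulas expressing types in gadgets -/

section ConstLocal

variable {L : FirstOrder.Language.{v, w}} {k : ℕ} (S : Set (Σ n, (gadgetLang L k).Relations n)) [Finite S]

/-- The tuple `x` of vertices of a gadget preceded by the roots. -/
def withRoots (L : FirstOrder.Language.{v, w}) (k : ℕ) {G : Type u} [(gadgetLang L k).Structure G]
    {α : Type} (x : α → G) : Fin k ⊕ α → G :=
  Sum.elim (root L k G) x

theorem range_withRoots_subset {G : Type u} [(gadgetLang L k).Structure G] {α : Type} (x : α → G) :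
    Set.range (withRoots L k x) ⊆ Set.range x ∪ constSet (gadgetLang L k) G := by
  rintro _ ⟨i | i, rfl⟩
  · exact Or.inr ⟨L.con i, rfl⟩
  · exact Or.inl ⟨i, rfl⟩

/-- A constant-local formula that expresses the type of some free variables and the roots in
their neighbourhood. -/
theorem exists_isConstLocal_rankType {α β : Type} [Finite α] (f : α → β) (r q : ℕ)
    (τ : RankType S q (Fin k ⊕ α)) :
    ∃ φ : (gadgetLang L k).Formula β, IsConstLocal.{u} φ ∧
      ∀ (G : Type u) [(gadgetLang L k).Structure G] (x : β → G), φ.Realize x ↔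
        rankType S (symbNbhd S r (Set.range (withRoots L k (x ∘ f)))) q
          (withRoots L k (x ∘ f)) = τ := by
  -- The variables standing for the roots are replaced by the constants. Every root thereby becomes
  -- a centre of the ball, as constant-locality allows.
  obtain ⟨φ, hφ⟩ := (isDefinable_rankType S r q id τ).subst
    (Sum.elim (fun i => Constants.term (L.con i)) (Term.var ∘ f))
  have hφ : ∀ (G : Type u) [(gadgetLang L k).Structure G] (x : β → G), φ.Realize x ↔
        rankType S (symbNbhd S r (Set.range (withRoots L k (x ∘ f)))) q
          (withRoots L k (x ∘ f)) = τ := by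
    intro G _ x
    refine (hφ G x).trans ?_
    have : (fun i => Term.realize x ((Sum.elim (fun i => Constants.term (L.con i)) (Term.var ∘ f) :
        Fin k ⊕ α → (gadgetLang L k).Term β) i)) = withRoots L k (x ∘ f) := by
      ext i
      rcases i with i | i
      · exact Term.realize_constants
      · rfl
    simp only [this, Function.comp_id]
  refine ⟨φ, ⟨r, fun M N _ _ _ _ a b e he => ?_⟩, hφ⟩
  have key : ∀ (G : Type u) [(gadgetLang L k).Structure G] (x : β → G),
      nbhd (gadgetLang L k) r (Set.range (withRoots L k (x ∘ f))) ⊆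
        nbhdSub (gadgetLang L k) r (Set.range x ∪ constSet (gadgetLang L k) G) := by
    rintro G _ x y ⟨z, hz, hzy⟩
    refine Substructure.subset_closure ⟨z, ?_, hzy⟩
    exact (range_withRoots_subset _).trans (Set.union_subset_union_left _
      (Set.range_comp_subset_range f x)) hz
  rw [hφ, hφ]
  refine Eq.congr_left (rankType_symbNbhd_eq_of_equiv e (key M a) (key N b)
    (fun i => key M a (subset_nbhd _ _ _ ⟨i, rfl⟩)) (fun i => key N b (subset_nbhd _ _ _ ⟨i, rfl⟩)) ?_ q)
  rintro (i | i)
  · have := e.map_constants (L.con i : (gadgetLang L k).Constants)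
    refine Eq.trans (congrArg e (Subtype.ext ?_)) (this.trans (Subtype.ext ?_))
    · exact ((Substructure.subtype _).map_constants _).symm
    · exact (Substructure.subtype _).map_constants _
  · exact he (f i)

end ConstLocal

/-! ### Transfer of local formulas along locally full maps -/

section Transfer

variable {L : FirstOrder.Language.{v, w}}

/-- The structure `M` in which all relations outside `S` are made empty. -/
def Reduct (_S : Set (Σ n, L.Relations n)) (M : Type u) : Type u := M

instance (S : Set (Σ n, L.Relations n)) (M : Type u) [L.Structure M] :
    L.Structure (Reduct S M) where
  funMap {_} f x := Structure.funMap (M := M) f x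
  RelMap {n} R t := ⟨n, R⟩ ∈ S ∧ Structure.RelMap (M := M) R t

instance (S : Set (Σ n, L.Relations n)) (M : Type u) [Finite M] : Finite (Reduct S M) :=
  inferInstanceAs (Finite M)

theorem relMap_reduct_iff {S : Set (Σ n, L.Relations n)} {M : Type u} [L.Structure M] {n : ℕ}
    {R : L.Relations n} {t : Fin n → M} :
    Structure.RelMap (M := Reduct S M) R t ↔ ⟨n, R⟩ ∈ S ∧ Structure.RelMap (M := M) R t :=
  Iff.rfl

theorem rankType_reduct {S : Set (Σ n, L.Relations n)} {M : Type u} [L.Structure M]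
    (U : Set M) (q : ℕ) {α : Type} (x : α → M) :
    rankType S U q x = rankType (M := Reduct S M) S U q x := by
  have h := rankType_map (M := M) (N := Reduct S M) (S := S) (fun y => y) (fun _ _ h => h)
    (fun n R hR t => relMap_reduct_iff.trans (and_iff_right hR)) U q x
  exact h.trans (congrArg (fun V : Set (Reduct S M) => rankType (M := Reduct S M) S V q x)
    (Set.image_id U))

variable {S : Set (Σ n, L.Relations n)} {α : Type} {M N : Type u} [L.Structure M] [L.Structure N]

/-- The layer `W i` contains the `i`-ball of `a`. Fullness lifts every tuple that meets the image of
a layer, so `f` is an isomorphism from the `r`-ball of `a` onto that of `f ∘ a`, and locality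
applies. With no symbols outside `S` in use, these are the Gaifman balls. -/
theorem realize_iff_of_locallyFull_aux [L.IsRelational] [IsEmpty (L.Relations 0)] [Finite M] [Finite N]
    {φ : L.Formula α} {r : ℕ} (hφ : IsLocalAt.{u} r φ)
    (hN : ∀ (n : ℕ) (R : L.Relations n) (t : Fin n → N), Structure.RelMap R t → ⟨n, R⟩ ∈ S)
    (hM : ∀ (n : ℕ) (R : L.Relations n) (t : Fin n → M), Structure.RelMap R t → ⟨n, R⟩ ∈ S)
    (f : N → M) (hf : Function.Injective f)
    (hpres : ∀ (n : ℕ) (R : L.Relations n) (t : Fin n → N), Structure.RelMap R t →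
      Structure.RelMap R (f ∘ t))
    (W : ℕ → Set N) (hW : ∀ i, W i ⊆ W (i + 1)) (a : α → N) (ha : Set.range a ⊆ W 0)
    (hfull : ∀ i ≤ r, ∀ (n : ℕ) (R : L.Relations n) (t : Fin n → M), Structure.RelMap R t →
      ∀ j, ∀ y ∈ W i, t j = f y → ∃ t' : Fin n → N, t = f ∘ t' ∧ Structure.RelMap R t' ∧
        ∀ l, t' l ∈ W (i + 1)) :
    φ.Realize a ↔ φ.Realize (f ∘ a) := by
  have h1 : ∀ i ≤ r + 1, symbNbhd S i (Set.range a) ⊆ W i := by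
    intro i
    induction i with
    | zero => exact fun _ => ha
    | succ i ih =>
      rintro hi y ⟨x, hx, rfl | ⟨R, t, ht, ⟨l, rfl⟩, ⟨l', rfl⟩⟩⟩
      · exact hW i (ih (by omega) hx)
      · obtain ⟨t', e, -, h⟩ := hfull i (by omega) _ _ _ (hpres _ _ _ ht) l _
          (ih (by omega) hx) rfl
        obtain rfl : t = t' := hf.comp_left e
        exact h l'
  have h2 : ∀ i, ∀ x ∈ symbNbhd S i (Set.range a), f x ∈ symbNbhd S i (Set.range (f ∘ a)) := by
    intro i
    induction i with
    | zero => rintro _ ⟨x, rfl⟩; exact ⟨x, rfl⟩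
    | succ i ih =>
      rintro y ⟨x, hx, rfl | ⟨R, t, ht, ⟨l, rfl⟩, ⟨l', rfl⟩⟩⟩
      · exact symbNbhd_subset_succ _ _ (ih _ hx)
      · exact mem_symbNbhd_succ_of_relMap R.2 (hpres _ _ _ ht) (i := l) (ih _ hx) l'
  have h3 : ∀ i ≤ r, ∀ y ∈ symbNbhd S i (Set.range (f ∘ a)),
      ∃ x ∈ symbNbhd S i (Set.range a), f x = y := by
    intro i
    induction i with
    | zero => rintro _ _ ⟨x, rfl⟩; exact ⟨a x, ⟨x, rfl⟩, rfl⟩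
    | succ i ih =>
      rintro hi y ⟨x, hx, rfl | ⟨R, t, ht, ⟨l, rfl⟩, ⟨l', rfl⟩⟩⟩
      · obtain ⟨z, hz, rfl⟩ := ih (by omega) _ hx
        exact ⟨z, symbNbhd_subset_succ _ _ hz, rfl⟩
      · obtain ⟨z, hz, e⟩ := ih (by omega) _ hx
        obtain ⟨t', rfl, ht', -⟩ := hfull i (by omega) _ _ _ ht l z (h1 i (by omega) hz) e.symm
        obtain rfl : z = t' l := hf e
        exact ⟨t' l', mem_symbNbhd_succ_of_relMap R.2 ht' hz l', rfl⟩
  have cN : ∀ x, x ∈ nbhdSub L r (Set.range a) ↔ x ∈ symbNbhd S r (Set.range a) := by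
    intro x
    rw [← SetLike.mem_coe, coe_nbhdSub]
    exact ⟨fun h => nbhd_subset_symbNbhd hN _ _ h, fun h => symbNbhd_subset_nbhd _ _ h⟩
  have cM : ∀ x, x ∈ nbhdSub L r (Set.range (f ∘ a)) ↔ x ∈ symbNbhd S r (Set.range (f ∘ a)) := by
    intro x
    rw [← SetLike.mem_coe, coe_nbhdSub]
    exact ⟨fun h => nbhd_subset_symbNbhd hM _ _ h, fun h => symbNbhd_subset_nbhd _ _ h⟩
  let g : nbhdSub L r (Set.range a) → nbhdSub L r (Set.range (f ∘ a)) :=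
    fun x => ⟨f x, (cM _).2 (h2 r x ((cN _).1 x.2))⟩
  have hg : Function.Bijective g := by
    constructor
    · intro x y e
      exact Subtype.ext (hf (congrArg Subtype.val e))
    · rintro ⟨y, hy⟩
      obtain ⟨x, hx, rfl⟩ := h3 r le_rfl y ((cM _).1 hy)
      exact ⟨⟨x, (cN _).2 hx⟩, rfl⟩
  let e : nbhdSub L r (Set.range a) ≃[L] nbhdSub L r (Set.range (f ∘ a)) :=
    { toEquiv := _root_.Equiv.ofBijective g hg
      map_fun' := fun {_} F _ => isEmptyElim F
      map_rel' := by
        intro n R t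
        constructor
        · intro h
          have h : Structure.RelMap R (f ∘ fun i => (t i : N)) := h
          rcases n with _ | n
          · exact isEmptyElim R
          · obtain ⟨t', e, ht', -⟩ := hfull r le_rfl _ _ _ h 0 (t 0)
              (h1 r (by omega) ((cN _).1 (t 0).2)) rfl
            have e := hf.comp_left e
            rw [← e] at ht'
            exact ht'
        · intro h
          exact hpres n R (fun i => (t i : N)) h }
  exact hφ N M a (f ∘ a) e fun i => rfl

/-- A local formula that uses only symbols from `S` is preserved by injective maps that preserve
the relations in `S` and are full near the free variables. -/
theorem realize_iff_of_locallyFull [L.IsRelational] [IsEmpty (L.Relations 0)] [Finite M] [Finite N]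
    {φ : L.Formula α} {r : ℕ} (hφ : IsLocalAt.{u} r φ) {q : ℕ}
    (hq : ∀ (M N : Type u) [L.Structure M] [L.Structure N] (x : α → M) (y : α → N),
      rankType S Set.univ q x = rankType S Set.univ q y → (φ.Realize x ↔ φ.Realize y))
    (f : N → M) (hf : Function.Injective f)
    (hpres : ∀ (n : ℕ) (R : L.Relations n), ⟨n, R⟩ ∈ S → ∀ t : Fin n → N, Structure.RelMap R t →
      Structure.RelMap R (f ∘ t))
    (W : ℕ → Set N) (hW : ∀ i, W i ⊆ W (i + 1)) (a : α → N) (ha : Set.range a ⊆ W 0)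
    (hfull : ∀ i ≤ r, ∀ (n : ℕ) (R : L.Relations n), ⟨n, R⟩ ∈ S → ∀ t : Fin n → M,
      Structure.RelMap R t → ∀ j, ∀ y ∈ W i, t j = f y → ∃ t' : Fin n → N, t = f ∘ t' ∧
        Structure.RelMap R t' ∧ ∀ l, t' l ∈ W (i + 1)) :
    φ.Realize a ↔ φ.Realize (f ∘ a) := by
  -- By `hq`, emptying the symbols outside `S` does not affect `φ`. Afterwards the Gaifman graphs
  -- come from `S` alone, where `hfull` gives control.
  have h1 : φ.Realize a ↔ φ.Realize (M := Reduct S N) a := hq N (Reduct S N) a a (rankType_reduct _ q a)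
  have h2 : φ.Realize (f ∘ a) ↔ φ.Realize (M := Reduct S M) (f ∘ a) :=
    hq M (Reduct S M) _ _ (rankType_reduct _ q _)
  rw [h1, h2]
  refine realize_iff_of_locallyFull_aux (M := Reduct S M) (N := Reduct S N) (S := S) hφ
    ?_ ?_ f hf ?_ W hW a ha ?_
  · exact fun n R t h => h.1
  · exact fun n R t h => h.1
  · exact fun n R t h => ⟨h.1, hpres n R h.1 t h.2⟩
  intro i hi n R t ht j y hy e
  obtain ⟨t', e', h', h''⟩ := hfull i hi n R ht.1 t ht.2 j y hy e
  exact ⟨t', e', ⟨ht.1, h'⟩, h''⟩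

end Transfer

/-! ### The vertices of a gadget product -/

section Vertices

variable {L : FirstOrder.Language.{v, w}} {k : ℕ} {A G : Type u} [(baseLang L k).Structure A]
  [(gadgetLang L k).Structure G]

theorem ofCopy_root (e : edges L k A) (i : Fin k) :
    ofCopy L k e (root L k G i) = ofBase L k (e.1 i) :=
  (Quot.sound (Glue.glue e i)).symm

/-- The vertices of a gadget other than the roots. -/
abbrev NonRoot (L : FirstOrder.Language.{v, w}) (k : ℕ) (G : Type u) [(gadgetLang L k).Structure G] :
    Type u :=
  {x : G // x ∉ Set.range (root L k G)}

open Classical in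
/-- The vertices of `A * G` are those of `A` and one copy of the non-roots of `G` for every edge. -/
def vertexEquiv (hroots : Function.Injective (root L k G)) :
    GadgetProd L k A G ≃ A ⊕ (edges L k A × NonRoot L k G) where
  toFun := Quot.lift (Sum.elim Sum.inl fun y =>
    if h : y.2 ∈ Set.range (root L k G) then Sum.inl (y.1.1 h.choose)
    else Sum.inr (y.1, ⟨y.2, h⟩)) (by
      rintro _ _ ⟨e, i⟩
      have h : root L k G i ∈ Set.range (root L k G) := ⟨i, rfl⟩
      simp only [Sum.elim_inl, Sum.elim_inr]
      rw [dif_pos h, hroots h.choose_spec])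
  invFun := Sum.elim (ofBase L k) fun y => ofCopy L k y.1 y.2.1
  left_inv := by
    rintro ⟨a | ⟨e, x⟩⟩
    · rfl
    · by_cases h : x ∈ Set.range (root L k G)
      · simp only [Sum.elim_inr, dif_pos h, Sum.elim_inl]
        rw [← ofCopy_root (G := G), h.choose_spec]
        rfl
      · simp only [Sum.elim_inr, dif_neg h]
        rfl
  right_inv := by
    rintro (a | ⟨e, x⟩)
    · rfl
    · exact dif_neg x.2

theorem vertexEquiv_ofBase (hroots : Function.Injective (root L k G)) (a : A) :
    vertexEquiv hroots (ofBase L k a) = Sum.inl a := rfl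

theorem vertexEquiv_ofCopy (hroots : Function.Injective (root L k G)) (e : edges L k A)
    (x : NonRoot L k G) : vertexEquiv hroots (ofCopy L k e x.1) = Sum.inr (e, x) :=
  (vertexEquiv hroots).right_inv (Sum.inr (e, x))

theorem finite_gadgetProd [Finite A] [Finite G] : Finite (GadgetProd L k A G) :=
  inferInstanceAs (Finite (Quot _))

variable (hroots : Function.Injective (root L k G))
include hroots

theorem ofBase_injective : Function.Injective (ofBase (G := G) L k : A → GadgetProd L k A G) :=
  fun _ _ h => Sum.inl_injective (congrArg (vertexEquiv hroots) h)

/-- In the normal form given by `vertexEquiv`, a root of a copy becomes a base vertex and a non-root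
stays in its copy. The quotient therefore identifies nothing beyond what the roots force. -/
theorem ofBase_eq_ofCopy_iff {a : A} {e : edges L k A} {x : G} :
    ofBase L k a = ofCopy L k e x ↔ ∃ i, x = root L k G i ∧ a = e.1 i := by
  constructor
  · intro h
    by_cases hx : x ∈ Set.range (root L k G)
    · obtain ⟨i, rfl⟩ := hx
      rw [ofCopy_root] at h
      exact ⟨i, rfl, ofBase_injective hroots h⟩
    · have := congrArg (vertexEquiv hroots) h
      rw [vertexEquiv_ofBase, vertexEquiv_ofCopy hroots e ⟨x, hx⟩] at this
      cases this
  · rintro ⟨i, rfl, rfl⟩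
    exact (ofCopy_root e i).symm

theorem ofCopy_eq_ofCopy_iff {e e' : edges L k A} {x x' : G} :
    ofCopy L k e x = ofCopy L k e' x' ↔ (e = e' ∧ x = x') ∨
      ∃ i i', x = root L k G i ∧ x' = root L k G i' ∧ e.1 i = e'.1 i' := by
  constructor
  · intro h
    by_cases hx : x ∈ Set.range (root L k G)
    · obtain ⟨i, rfl⟩ := hx
      rw [ofCopy_root, ofBase_eq_ofCopy_iff hroots] at h
      obtain ⟨i', rfl, h⟩ := h
      exact Or.inr ⟨i, i', rfl, rfl, h⟩
    · by_cases hx' : x' ∈ Set.range (root L k G)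
      · obtain ⟨i, rfl⟩ := hx'
        rw [ofCopy_root, eq_comm, ofBase_eq_ofCopy_iff hroots] at h
        obtain ⟨i', rfl, h⟩ := h
        exact Or.inr ⟨i', i, rfl, rfl, h.symm⟩
      · have := congrArg (vertexEquiv hroots) h
        rw [vertexEquiv_ofCopy hroots e ⟨x, hx⟩, vertexEquiv_ofCopy hroots e' ⟨x', hx'⟩] at this
        simp only [Sum.inr.injEq, Prod.mk.injEq, Subtype.mk.injEq] at this
        exact Or.inl this
  · rintro (⟨rfl, rfl⟩ | ⟨i, i', rfl, rfl, h⟩)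
    · rfl
    · rw [ofCopy_root, ofCopy_root, h]

theorem isInternal_ofCopy_iff {e : edges L k A} {x : G} :
    IsInternal L k (ofCopy L k e x) ↔ x ∈ Set.range (root L k G) := by
  constructor
  · rintro ⟨a, h⟩
    obtain ⟨i, rfl, -⟩ := (ofBase_eq_ofCopy_iff hroots).1 h.symm
    exact ⟨i, rfl⟩
  · rintro ⟨i, rfl⟩
    exact ⟨e.1 i, ofCopy_root e i⟩

theorem inCopy_ofCopy_iff {e e' : edges L k A} {x : G} (hx : x ∉ Set.range (root L k G)) :
    InCopy L k (ofCopy L k e x) e' ↔ e = e' := by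
  constructor
  · rintro ⟨y, h⟩
    rcases (ofCopy_eq_ofCopy_iff hroots).1 h with h | ⟨i, -, rfl, -⟩
    · exact h.1
    · exact absurd ⟨i, rfl⟩ hx
  · rintro rfl
    exact ⟨x, rfl⟩

end Vertices

/-! ### Composition of types in gadget products -/

section Composition

variable {L : FirstOrder.Language.{v, w}} {k : ℕ}

/-- The symbols from `S`, as symbols of the base language, together with `R`. -/
def baseSymbols (k : ℕ) (S : Set (Σ n, L.Relations n)) : Set (Σ n, (baseLang L k).Relations n) :=
  insert ⟨k, Sum.inr EdgeSym.R⟩ ((fun R => ⟨R.1, Sum.inl R.2⟩) '' S)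

/-- The symbols from `S`, as symbols of the gadget language. -/
def gadgetSymbols (k : ℕ) (S : Set (Σ n, L.Relations n)) :
    Set (Σ n, (gadgetLang L k).Relations n) :=
  (fun R => ⟨R.1, Sum.inl R.2⟩) '' S

theorem inl_mem_baseSymbols {S : Set (Σ n, L.Relations n)} {n : ℕ} {R : L.Relations n}
    (hR : ⟨n, R⟩ ∈ S) : (⟨n, Sum.inl R⟩ : Σ n, (baseLang L k).Relations n) ∈ baseSymbols k S :=
  Set.mem_insert_of_mem _ ⟨_, hR, rfl⟩

theorem inl_mem_gadgetSymbols {S : Set (Σ n, L.Relations n)} {n : ℕ} {R : L.Relations n}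
    (hR : ⟨n, R⟩ ∈ S) : (⟨n, Sum.inl R⟩ : Σ n, (gadgetLang L k).Relations n) ∈ gadgetSymbols k S :=
  ⟨_, hR, rfl⟩

instance (S : Set (Σ n, L.Relations n)) [Finite S] : Finite (baseSymbols k S) :=
  ((Set.toFinite S).image _).insert _

instance (S : Set (Σ n, L.Relations n)) [Finite S] : Finite (gadgetSymbols k S) :=
  (Set.toFinite S).image _

/-- A tuple of vertices of the base structure, some of which form distinct distinguished edges,
and a tuple of vertices of the gadget for each of these edges. -/
structure Config (L : FirstOrder.Language.{v, w}) (A G : Type u) {k : ℕ} [(baseLang L k).Structure A]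
    [(gadgetLang L k).Structure G] {β J : Type} (Γ : Type) (ι : J → Fin k → β) where
  base : β → A
  edge : J → edges L k A
  copy : J → Γ → G
  edge_injective : Function.Injective edge
  edge_eq : ∀ j i, (edge j).1 i = base (ι j i)

namespace Config

variable {A G : Type u} [(baseLang L k).Structure A] [(gadgetLang L k).Structure G]
  {β J Γ : Type} {ι : J → Fin k → β}

/-- All the vertices of the gadget product listed in a configuration. -/
def tuple (C : Config L A G Γ ι) : β ⊕ J × (Fin k ⊕ Γ) → GadgetProd L k A G :=
  Sum.elim (fun i => ofBase L k (C.base i))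
    fun j => ofCopy L k (C.edge j.1) (withRoots L k (C.copy j.1) j.2)

/-- The configuration with one more vertex of the base structure. -/
def addBase (C : Config L A G Γ ι) (a : A) :
    Config L A G Γ (fun j i => (Sum.inl (ι j i) : β ⊕ Unit)) where
  base := extend C.base a
  edge := C.edge
  copy := C.copy
  edge_injective := C.edge_injective
  edge_eq := C.edge_eq

open Classical in
/-- The configuration with one more vertex in the copy of the gadget on a distinguished edge. The
tuples in the other copies are continued with a root. -/
def addCopy (C : Config L A G Γ ι) (i₀ : Fin k) (j : J) (x : G) : Config L A G (Γ ⊕ Unit) ι where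
  base := C.base
  edge := C.edge
  copy j' := extend (C.copy j') (if j' = j then x else root L k G i₀)
  edge_injective := C.edge_injective
  edge_eq := C.edge_eq

/-- The configuration with one more distinguished edge. -/
def addEdge (C : Config L A G Γ ι) (i₀ : Fin k) (e : edges L k A) (he : ∀ j, C.edge j ≠ e) :
    Config L A G Γ (fun (j : Option J) i =>
      (j.elim (Sum.inr i) fun j => Sum.inl (ι j i) : β ⊕ Fin k)) where
  base := Sum.elim C.base e.1
  edge j := j.elim e C.edge
  copy j := j.elim (fun _ => root L k G i₀) C.copy
  edge_injective := by
    rintro (_ | j) (_ | j') h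
    · rfl
    · exact absurd h.symm (he j')
    · exact absurd h (he j)
    · exact congrArg some (C.edge_injective h)
  edge_eq := by
    rintro (_ | j) i
    · rfl
    · exact C.edge_eq j i

theorem extend_tuple_ofBase (C : Config L A G Γ ι) (a : A) :
    extend C.tuple (ofBase L k a) =
      (C.addBase a).tuple ∘ Sum.elim (Sum.map Sum.inl id) (fun _ => Sum.inl (Sum.inr ())) := by
  ext i
  rcases i with (i | i) | i <;> rfl

theorem tuple_addCopy (C : Config L A G Γ ι) (i₀ : Fin k) (j : J) (x : G) :
    extend C.tuple (ofCopy L k (C.edge j) x) = (C.addCopy i₀ j x).tuple ∘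
      Sum.elim (Sum.map id (Prod.map id (Sum.map id Sum.inl)))
        (fun _ => Sum.inr (j, Sum.inr (Sum.inr ()))) := by
  ext i
  rcases i with (i | ⟨j', i | i⟩) | i
  · rfl
  · rfl
  · rfl
  · simp [extend, tuple, addCopy, withRoots]

theorem tuple_addEdge (C : Config L A G Γ ι) (i₀ : Fin k) (e : edges L k A)
    (he : ∀ j, C.edge j ≠ e) :
    C.tuple = (C.addEdge i₀ e he).tuple ∘ Sum.map Sum.inl (Prod.map some id) := by
  ext i
  rcases i with i | ⟨j', i | i⟩ <;> rfl

/-- The vertices of the base structure, and the vertices in `D e` of the copy on each edge `e`. -/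
def domain (D : edges L k A → Set G) : Set (GadgetProd L k A G) :=
  {y | (∃ a, y = ofBase L k a) ∨ ∃ e, ∃ x ∈ D e, y = ofCopy L k e x}

end Config

variable {A G A' G' : Type u} [(baseLang L k).Structure A] [(gadgetLang L k).Structure G]
  [(baseLang L k).Structure A'] [(gadgetLang L k).Structure G']
  {β J Γ : Type} {ι : J → Fin k → β}

/-- Two configurations whose parts have the same types of rank `q`. -/
structure Matches (S : Set (Σ n, L.Relations n)) (q : ℕ) (D : edges L k A → Set G) (D₀ : Set G)
    (D' : edges L k A' → Set G') (D₀' : Set G') (C : Config L A G Γ ι) (C' : Config L A' G' Γ ι) :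
    Prop where
  base : rankType (baseSymbols k S) Set.univ q C.base = rankType (baseSymbols k S) Set.univ q C'.base
  copy : ∀ j, rankType (gadgetSymbols k S) (D (C.edge j)) q (withRoots L k (C.copy j)) =
    rankType (gadgetSymbols k S) (D' (C'.edge j)) q (withRoots L k (C'.copy j))
  rest : rankType (gadgetSymbols k S) D₀ q (root L k G) =
    rankType (gadgetSymbols k S) D₀' q (root L k G')
  left : ∀ e, (∀ j, C.edge j ≠ e) → D e = D₀
  right : ∀ e, (∀ j, C'.edge j ≠ e) → D' e = D₀'

/-! ### Moves of the game on matching configurations -/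

namespace Matches

variable {S : Set (Σ n, L.Relations n)} {q : ℕ} {D : edges L k A → Set G} {D₀ : Set G}
  {D' : edges L k A' → Set G'} {D₀' : Set G'} {C : Config L A G Γ ι} {C' : Config L A' G' Γ ι}

theorem symm (h : Matches S q D D₀ D' D₀' C C') : Matches S q D' D₀' D D₀ C' C :=
  ⟨h.base.symm, fun j => (h.copy j).symm, h.rest.symm, h.right, h.left⟩

theorem mono {q' : ℕ} (hq : q' ≤ q) (h : Matches S q D D₀ D' D₀' C C') :
    Matches S q' D D₀ D' D₀' C C' :=
  ⟨rankType_of_le hq h.base, fun j => rankType_of_le hq (h.copy j), rankType_of_le hq h.rest,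
    h.left, h.right⟩

theorem addBase (h : Matches S (q + 1) D D₀ D' D₀' C C') (a : A) :
    ∃ a', Matches S q D D₀ D' D₀' (C.addBase a) (C'.addBase a') := by
  obtain ⟨a', -, e⟩ := (rankType_succ_iff.1 h.base).2.1 a trivial
  exact ⟨a', e, fun j => rankType_of_succ (h.copy j), rankType_of_succ h.rest, h.left, h.right⟩

theorem withRoots_extend {G : Type u} [(gadgetLang L k).Structure G] (x : Γ → G) (y : G) :
    withRoots L k (extend x y) = extend (withRoots L k x) y ∘
      Sum.elim (fun i => Sum.inl (Sum.inl i)) (Sum.map Sum.inr id) := by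
  ext i
  rcases i with i | i | i <;> rfl

theorem withRoots_extend_root {G : Type u} [(gadgetLang L k).Structure G] (x : Γ → G) (i₀ : Fin k) :
    withRoots L k (extend x (root L k G i₀)) = withRoots L k x ∘
      Sum.elim Sum.inl (Sum.elim Sum.inr fun _ => Sum.inl i₀) := by
  ext i
  rcases i with i | i | i <;> rfl

theorem withRoots_const_root {G : Type u} [(gadgetLang L k).Structure G] (i₀ : Fin k) :
    withRoots L k (fun _ : Γ => root L k G i₀) = root L k G ∘ Sum.elim id (fun _ => i₀) := by
  ext i
  rcases i with i | i <;> rfl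

theorem addCopy (h : Matches S (q + 1) D D₀ D' D₀' C C') (i₀ : Fin k) (j : J) {x : G}
    (hx : x ∈ D (C.edge j)) : ∃ x' ∈ D' (C'.edge j),
      Matches S q D D₀ D' D₀' (C.addCopy i₀ j x) (C'.addCopy i₀ j x') := by
  obtain ⟨x', hx', e⟩ := (rankType_succ_iff.1 (h.copy j)).2.1 x hx
  refine ⟨x', hx', rankType_of_succ h.base, fun j' => ?_, rankType_of_succ h.rest, h.left, h.right⟩
  by_cases hj : j' = j
  · subst hj
    simp only [Config.addCopy, if_true, withRoots_extend]
    exact rankType_reindex e _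
  · simp only [Config.addCopy, if_neg hj, withRoots_extend_root]
    exact rankType_reindex (rankType_of_succ (h.copy j')) _

/-- Naming a new edge takes `k` moves in the base. Its copy has no listed vertices besides the
roots, so the single type `rest`, common to all unnamed copies, serves for it. -/
theorem addEdge (h : Matches S (q + k) D D₀ D' D₀' C C') (i₀ : Fin k) (e : edges L k A)
    (he : ∀ j, C.edge j ≠ e) : ∃ e', ∃ he' : ∀ j, C'.edge j ≠ e',
      Matches S q D D₀ D' D₀' (C.addEdge i₀ e he) (C'.addEdge i₀ e' he') := by
  obtain ⟨e', -, hee⟩ := rankType_add h.base e.1 (fun _ => trivial)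
  -- The atomic part of the type records `R`, so the answer is an edge, and it records equalities
  -- with the listed endpoints, so this edge is new.
  have h0 := rankType_zero_iff.1 (rankType_of_le (Nat.zero_le q) hee)
  have hR : e' ∈ edges L k A' := (h0.2 k _ (Set.mem_insert _ _) Sum.inr).1 e.2
  have hne : ∀ j, C'.edge j ≠ ⟨e', hR⟩ := by
    intro j hj
    refine he j (Subtype.ext (funext fun i => ?_))
    rw [C.edge_eq]
    refine (h0.1 (Sum.inl (ι j i)) (Sum.inr i)).2 ?_
    exact (C'.edge_eq j i).symm.trans (congrFun (congrArg Subtype.val hj) i)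
  refine ⟨⟨e', hR⟩, hne, hee, ?_, rankType_of_le (Nat.le_add_right _ _) h.rest, ?_, ?_⟩
  · rintro (_ | j)
    · have h1 : D e = D₀ := h.left e he
      have h2 : D' ⟨e', hR⟩ = D₀' := h.right _ hne
      have := rankType_of_le (Nat.le_add_right q k) h.rest
      simp only [Config.addEdge, Option.elim, withRoots_const_root, h1, h2]
      exact rankType_reindex this _
    · exact rankType_of_le (Nat.le_add_right _ _) (h.copy j)
  · exact fun e' he' => h.left e' fun j => he' (some j)
  · exact fun e' he' => h.right e' fun j => he' (some j)

variable (hG : Function.Injective (root L k G)) (hG' : Function.Injective (root L k G'))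
include hG hG'

/-- Listed vertices coincide through an equality in the base, an equality within one copy, or shared
roots. The endpoints of named edges and the roots are listed, so atomic types see all three. -/
theorem tuple_eq (h : Matches S 0 D D₀ D' D₀' C C') {i j : β ⊕ J × (Fin k ⊕ Γ)}
    (hij : C.tuple i = C.tuple j) : C'.tuple i = C'.tuple j := by
  have hb := (rankType_zero_iff.1 h.base).1
  have hc := fun l => (rankType_zero_iff.1 (h.copy l)).1
  have key : ∀ i l g, C.tuple (Sum.inl i) = C.tuple (Sum.inr (l, g)) →
      C'.tuple (Sum.inl i) = C'.tuple (Sum.inr (l, g)) := by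
    intro i l g hij
    obtain ⟨s, h1, h2⟩ := (ofBase_eq_ofCopy_iff hG).1 hij
    refine (ofBase_eq_ofCopy_iff hG').2 ⟨s, (hc l g (Sum.inl s)).1 h1, ?_⟩
    rw [C'.edge_eq]
    rw [C.edge_eq] at h2
    exact (hb _ _).1 h2
  rcases i with i | ⟨l, g⟩ <;> rcases j with j | ⟨l', g'⟩
  · exact congrArg (ofBase L k) ((hb i j).1 (ofBase_injective hG hij))
  · exact key _ _ _ hij
  · exact (key _ _ _ hij.symm).symm
  · rcases (ofCopy_eq_ofCopy_iff hG).1 hij with ⟨h1, h2⟩ | ⟨s, s', h1, h2, h3⟩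
    · obtain rfl : l = l' := C.edge_injective h1
      exact congrArg (ofCopy L k _) ((hc l g g').1 h2)
    · refine (ofCopy_eq_ofCopy_iff hG').2 (Or.inr ⟨s, s', (hc l g (Sum.inl s)).1 h1,
        (hc l' g' (Sum.inl s')).1 h2, ?_⟩)
      rw [C'.edge_eq, C'.edge_eq]
      rw [C.edge_eq, C.edge_eq] at h3
      exact (hb _ _).1 h3

variable [L.IsRelational]

/-- A listed vertex lying in the copy on a named edge is listed in that copy or is one of its roots,
so the gadget type of that copy decides the relation. -/
theorem relMap_of_edge (h : Matches S 0 D D₀ D' D₀' C C') {n : ℕ} {R : L.Relations n}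
    (hR : ⟨n, R⟩ ∈ S) {t : Fin n → β ⊕ J × (Fin k ⊕ Γ)} {j : J} {x : Fin n → G}
    (hx : Structure.RelMap (L := gadgetLang L k) (Sum.inl R) x)
    (ht : C.tuple ∘ t = fun l => ofCopy L k (C.edge j) (x l)) :
    Structure.RelMap R (C'.tuple ∘ t) := by
  have : ∀ l, ∃ g, x l = withRoots L k (C.copy j) g := by
    intro l
    have hl : C.tuple (t l) = ofCopy L k (C.edge j) (x l) := congrFun ht l
    rcases htl : t l with i | ⟨j', g⟩ <;> rw [htl] at hl
    · obtain ⟨s, h1, -⟩ := (ofBase_eq_ofCopy_iff hG).1 hl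
      exact ⟨Sum.inl s, h1⟩
    · rcases (ofCopy_eq_ofCopy_iff hG).1 hl with ⟨h1, h2⟩ | ⟨-, s, -, h2, -⟩
      · obtain rfl : j' = j := C.edge_injective h1
        exact ⟨g, h2.symm⟩
      · exact ⟨Sum.inl s, h2⟩
  choose g hg using this
  obtain rfl : x = withRoots L k (C.copy j) ∘ g := funext hg
  refine Or.inr ⟨C'.edge j, withRoots L k (C'.copy j) ∘ g,
    ((rankType_zero_iff.1 (h.copy j)).2 n _ (inl_mem_gadgetSymbols hR) g).1 hx, funext fun l => ?_⟩
  exact tuple_eq hG hG' h (i := t l) (j := Sum.inr (j, g l)) (congrFun ht l)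

/-- A relation among listed vertices may come from the copy on an unnamed edge, with all entries at
its roots. That edge must first be named, which is why rank `k` rather than `0` is needed. -/
theorem relMap (hk : 0 < k) (h : Matches S k D D₀ D' D₀' C C') {n : ℕ} {R : L.Relations n}
    (hR : ⟨n, R⟩ ∈ S) {t : Fin n → β ⊕ J × (Fin k ⊕ Γ)}
    (ht : Structure.RelMap R (C.tuple ∘ t)) : Structure.RelMap R (C'.tuple ∘ t) := by
  have h0 := h.mono (Nat.zero_le k)
  rcases ht with ⟨a, ha, ht⟩ | ⟨e, x, hx, ht⟩
  · have : ∀ l, ∃ i, a l = C.base i := by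
      intro l
      have hl : C.tuple (t l) = ofBase L k (a l) := congrFun ht l
      rcases htl : t l with i | ⟨j, g⟩ <;> rw [htl] at hl
      · exact ⟨i, (ofBase_injective hG hl).symm⟩
      · obtain ⟨s, -, h1⟩ := (ofBase_eq_ofCopy_iff hG).1 hl.symm
        exact ⟨ι j s, h1.trans (C.edge_eq j s)⟩
    choose i hi using this
    obtain rfl : a = C.base ∘ i := funext hi
    refine Or.inl ⟨C'.base ∘ i, ((rankType_zero_iff.1 h0.base).2 n _
      (inl_mem_baseSymbols hR) i).1 ha, funext fun l => ?_⟩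
    exact tuple_eq hG hG' h0 (i := t l) (j := Sum.inl (i l)) (congrFun ht l)
  · by_cases he : ∃ j, C.edge j = e
    · obtain ⟨j, rfl⟩ := he
      exact relMap_of_edge hG hG' h0 hR hx ht
    · obtain ⟨e', he', h'⟩ := Matches.addEdge (q := 0) (by rwa [zero_add]) ⟨0, hk⟩ e (not_exists.1 he)
      rw [C.tuple_addEdge ⟨0, hk⟩ e (not_exists.1 he), Function.comp_assoc] at ht
      rw [C'.tuple_addEdge ⟨0, hk⟩ e' he', Function.comp_assoc]
      exact relMap_of_edge hG hG' h' hR (j := none) hx ht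

theorem rankType_zero (hk : 0 < k) (h : Matches S k D D₀ D' D₀' C C') :
    rankType S (Config.domain D) 0 C.tuple = rankType S (Config.domain D') 0 C'.tuple := by
  have h0 := h.mono (Nat.zero_le k)
  exact rankType_zero_iff.2 ⟨fun i j => ⟨tuple_eq hG hG' h0, tuple_eq hG' hG h0.symm⟩,
    fun n R hR t => ⟨relMap hG hG' hk h hR, relMap hG' hG hk h.symm hR⟩⟩

end Matches

/-- Matching configurations list tuples of the same type of rank `q`. -/
def DeterminesRank (k : ℕ) [L.IsRelational] (S : Set (Σ n, L.Relations n)) (q : ℕ) : Prop :=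
  ∀ (A G A' G' : Type u) [(baseLang L k).Structure A] [(gadgetLang L k).Structure G]
    [(baseLang L k).Structure A'] [(gadgetLang L k).Structure G'],
    Function.Injective (root L k G) → Function.Injective (root L k G') →
    ∀ (β J Γ : Type) (ι : J → Fin k → β) (D : edges L k A → Set G) (D₀ : Set G)
      (D' : edges L k A' → Set G') (D₀' : Set G') (C : Config L A G Γ ι) (C' : Config L A' G' Γ ι),
      Matches S (q * (k + 1) + k) D D₀ D' D₀' C C' →
      rankType S (Config.domain D) q C.tuple = rankType S (Config.domain D') q C'.tuple

/-- A vertex of the product is a base vertex, a vertex in a named copy or a vertex in an unnamed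
copy. The last case is the dearest, with `k` moves for the edge and one for the vertex. -/
theorem DeterminesRank.forth [L.IsRelational] (hk : 0 < k) {S : Set (Σ n, L.Relations n)} {q : ℕ}
    (hq : DeterminesRank.{u} k S q) (hG : Function.Injective (root L k G))
    (hG' : Function.Injective (root L k G')) {D : edges L k A → Set G} {D₀ : Set G}
    {D' : edges L k A' → Set G'} {D₀' : Set G'} {C : Config L A G Γ ι} {C' : Config L A' G' Γ ι}
    (h : Matches S ((q + 1) * (k + 1) + k) D D₀ D' D₀' C C') {y : GadgetProd L k A G}
    (hy : y ∈ Config.domain D) : ∃ y' ∈ Config.domain D',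
      rankType S (Config.domain D) q (extend C.tuple y) =
        rankType S (Config.domain D') q (extend C'.tuple y') := by
  -- One round costs `k + 1` ranks; the final `k` remains in reserve for the atomic stage.
  have e1 : (q + 1) * (k + 1) + k = (q * (k + 1) + k + 1) + k := by ring
  rw [e1] at h
  have h1 := h.mono (Nat.le_add_right _ k)
  rcases hy with ⟨a, rfl⟩ | ⟨e, x, hx, rfl⟩
  · obtain ⟨a', h'⟩ := h1.addBase a
    refine ⟨ofBase L k a', Or.inl ⟨a', rfl⟩, ?_⟩
    rw [C.extend_tuple_ofBase, C'.extend_tuple_ofBase]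
    exact rankType_reindex (hq _ _ _ _ hG hG' _ _ _ _ _ _ _ _ _ _ h') _
  · by_cases he : ∃ j, C.edge j = e
    · obtain ⟨j, rfl⟩ := he
      obtain ⟨x', hx', h'⟩ := h1.addCopy ⟨0, hk⟩ j hx
      refine ⟨ofCopy L k (C'.edge j) x', Or.inr ⟨_, x', hx', rfl⟩, ?_⟩
      rw [C.tuple_addCopy ⟨0, hk⟩, C'.tuple_addCopy ⟨0, hk⟩]
      exact rankType_reindex (hq _ _ _ _ hG hG' _ _ _ _ _ _ _ _ _ _ h') _
    · obtain ⟨e', he', h2⟩ := h.addEdge ⟨0, hk⟩ e (not_exists.1 he)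
      obtain ⟨x', hx', h'⟩ := h2.addCopy ⟨0, hk⟩ none hx
      refine ⟨ofCopy L k e' x', Or.inr ⟨_, x', hx', rfl⟩, ?_⟩
      rw [C.tuple_addEdge ⟨0, hk⟩ e (not_exists.1 he), C'.tuple_addEdge ⟨0, hk⟩ e' he',
        extend_comp, extend_comp]
      have t1 := (C.addEdge ⟨0, hk⟩ e (not_exists.1 he)).tuple_addCopy ⟨0, hk⟩ none x
      have t2 := (C'.addEdge ⟨0, hk⟩ e' he').tuple_addCopy ⟨0, hk⟩ none x'
      refine rankType_reindex ?_ _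
      refine (congrArg (rankType S (Config.domain D) q) t1).trans (Eq.trans ?_
        (congrArg (rankType S (Config.domain D') q) t2).symm)
      exact rankType_reindex (hq _ _ _ _ hG hG' _ _ _ _ _ _ _ _ _ _ h') _

theorem determinesRank [L.IsRelational] (hk : 0 < k) (S : Set (Σ n, L.Relations n)) (q : ℕ) :
    DeterminesRank.{u} k S q := by
  induction q with
  | zero =>
    intro A G A' G' _ _ _ _ hG hG' β J Γ ι D D₀ D' D₀' C C' h
    exact (h.mono (by omega)).rankType_zero hG hG' hk
  | succ q ih =>
    intro A G A' G' _ _ _ _ hG hG' β J Γ ι D D₀ D' D₀' C C' h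
    refine rankType_succ_iff.2 ⟨(h.mono (by omega)).rankType_zero hG hG' hk,
      fun y hy => ih.forth hk hG hG' h hy, fun y hy => ?_⟩
    obtain ⟨y', hy', e⟩ := ih.forth hk hG' hG h.symm hy
    exact ⟨y', hy', e.symm⟩

end Composition

/-! ### Restriction of gadget products to neighbourhoods -/

section Restriction

variable {L : FirstOrder.Language.{v, w}} {k : ℕ} {A G : Type u} [(baseLang L k).Structure A]
  [(gadgetLang L k).Structure G]

/-- An edge of a substructure of the base structure, as an edge of the base structure. -/
def edgeIncl (B : (baseLang L k).Substructure A) (e : edges L k B) : edges L k A :=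
  ⟨fun i => (e.1 i : A), e.2⟩

theorem edgeIncl_injective (B : (baseLang L k).Substructure A) :
    Function.Injective (edgeIncl B) := fun _ _ h =>
  Subtype.ext (funext fun i => Subtype.ext (congrFun (congrArg Subtype.val h) i))

/-- The inclusion of gadget products induced by a substructure of the base structure. -/
def prodIncl (B : (baseLang L k).Substructure A) : GadgetProd L k B G → GadgetProd L k A G :=
  Quot.map (Sum.map (fun a => (a : A)) (Prod.map (edgeIncl B) id)) (by
    rintro _ _ ⟨e, i⟩
    exact Glue.glue (edgeIncl B e) i)

/-- Two vertices are identified through roots exactly when certain base vertices are equal, and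
equality in `B` is equality in `A`. -/
theorem prodIncl_injective (hroots : Function.Injective (root L k G))
    (B : (baseLang L k).Substructure A) :
    Function.Injective (prodIncl (G := G) B) := by
  have key : ∀ (a : B) (e : edges L k B) (x : G),
      ofBase L k (a : A) = ofCopy L k (edgeIncl B e) x → ofBase L k a = ofCopy L k e x := by
    intro a e x h
    obtain ⟨i, h1, h2⟩ := (ofBase_eq_ofCopy_iff hroots).1 h
    exact (ofBase_eq_ofCopy_iff hroots).2 ⟨i, h1, Subtype.ext h2⟩
  rintro ⟨a | ⟨e, x⟩⟩ ⟨a' | ⟨e', x'⟩⟩ h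
  · exact congrArg (ofBase L k) (Subtype.ext (ofBase_injective hroots h))
  · exact key a e' x' h
  · exact (key a' e x h.symm).symm
  · rcases (ofCopy_eq_ofCopy_iff hroots).1 h with ⟨h1, h2⟩ | ⟨i, i', h1, h2, h3⟩
    · obtain rfl := edgeIncl_injective B h1
      exact congrArg (ofCopy L k e) h2
    · exact (ofCopy_eq_ofCopy_iff hroots).2 (Or.inr ⟨i, i', h1, h2, Subtype.ext h3⟩)

variable {α β ι : Type}

/-- The vertices of `A * G` given by vertices of `A` and by edges of `A` with vertices of `G`. -/
def listed (b : β → A) (e : ι → edges L k A) (x : ι → G) : β ⊕ ι → GadgetProd L k A G :=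
  Sum.elim (fun i => ofBase L k (b i)) fun i => ofCopy L k (e i) (x i)

variable [L.IsRelational]

/-- The substructure of the base structure on a neighbourhood of `b`. -/
def ball (S : Set (Σ n, L.Relations n)) (r : ℕ) (b : β → A) : (baseLang L k).Substructure A where
  carrier := symbNbhd (baseSymbols k S) r (Set.range b)
  fun_mem f := isEmptyElim f

/-- The tuple `b`, as a tuple of vertices of its neighbourhood. -/
def ballTuple (S : Set (Σ n, L.Relations n)) (r : ℕ) (b : β → A) (i : β) : ball (k := k) S r b :=
  ⟨b i, subset_symbNbhd r _ ⟨i, rfl⟩⟩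

/-- Edges with vertices in `b`, as edges of the neighbourhood of `b`. -/
def ballEdge (S : Set (Σ n, L.Relations n)) (r : ℕ) (b : β → A) (e : ι → edges L k A)
    (he : ∀ i s, (e i).1 s ∈ Set.range b) (i : ι) : edges L k (ball (k := k) S r b) :=
  ⟨fun s => ⟨(e i).1 s, subset_symbNbhd r _ (he i s)⟩, (e i).2⟩

/-- The roots and the listed vertices of the copy on the edge `e'`. -/
def centers (e : ι → edges L k A) (x : ι → G) (e' : edges L k A) : Set G :=
  Set.range (root L k G) ∪ {y | ∃ i, e i = e' ∧ x i = y}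

/-- Neighbourhoods in the copies on the edges of a substructure. -/
def copyBalls (S : Set (Σ n, L.Relations n)) (r : ℕ) (e : ι → edges L k A) (x : ι → G)
    (B : (baseLang L k).Substructure A) (e' : edges L k B) : Set G :=
  symbNbhd (gadgetSymbols k S) r (centers e x (edgeIncl B e'))

/-- The structure induced by a set of vertices of a gadget product. -/
def domainSub (D : edges L k A → Set G) : L.Substructure (GadgetProd L k A G) where
  carrier := Config.domain D
  fun_mem f := isEmptyElim f

theorem listed_mem_domain (S : Set (Σ n, L.Relations n)) (r : ℕ) (b : β → A) (e : ι → edges L k A)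
    (x : ι → G) (he : ∀ i s, (e i).1 s ∈ Set.range b) (i : β ⊕ ι) :
    listed (ballTuple (k := k) S r b) (ballEdge S r b e he) x i ∈
      domainSub (copyBalls S r e x (ball S r b)) := by
  rcases i with i | i
  · exact Or.inl ⟨_, rfl⟩
  · exact Or.inr ⟨ballEdge S r b e he i, x i, subset_symbNbhd _ _ (Or.inr ⟨i, rfl, rfl⟩), rfl⟩

/-- The truth of a local formula is determined in a gadget product of neighbourhoods. -/
theorem realize_iff_realize_domainSub (hk : 0 < k) [IsEmpty (L.Relations 0)] [Finite A] [Finite G]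
    (hroots : Function.Injective (root L k G)) {φ : L.Formula α} {r : ℕ}
    (hφ : IsLocalAt.{u} r φ) {S : Set (Σ n, L.Relations n)} {q : ℕ}
    (hq : ∀ (M N : Type u) [L.Structure M] [L.Structure N] (x : α → M) (y : α → N),
      rankType S Set.univ q x = rankType S Set.univ q y → (φ.Realize x ↔ φ.Realize y))
    (b : β → A) (e : ι → edges L k A) (x : ι → G) (he : ∀ i s, (e i).1 s ∈ Set.range b)
    (hx : ∀ i, x i ∉ Set.range (root L k G)) (σ : α → β ⊕ ι) :
    φ.Realize (listed b e x ∘ σ) ↔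
      φ.Realize (M := domainSub (copyBalls S (r + 1) e x (ball S (r + 1) b)))
        (fun i => ⟨_, listed_mem_domain S (r + 1) b e x he (σ i)⟩) := by
  have := finite_gadgetProd (L := L) (k := k) (A := A) (G := G)
  set B := ball (k := k) S (r + 1) b
  have := finite_gadgetProd (L := L) (k := k) (A := B) (G := G)
  set D := copyBalls S (r + 1) e x B
  let f : domainSub D → GadgetProd L k A G := fun y => prodIncl B y.1
  have hf : Function.Injective f := (prodIncl_injective hroots B).comp Subtype.val_injective
  let near : ℕ → Set A := fun i => symbNbhd (baseSymbols k S) i (Set.range b)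
  let nearG : ℕ → edges L k B → Set G := fun i e' =>
    symbNbhd (gadgetSymbols k S) i (centers e x (edgeIncl B e'))
  -- The layers for `realize_iff_of_locallyFull`. Roots count only as base vertices, so that
  -- distance in the base governs passage between copies. A copy belongs to the layer as soon as its
  -- edge meets the base ball. Lifting from layer `r` lands in layer `r + 1`, whence the radius `r +
  -- 1` of the domain.
  let W : ℕ → Set (GadgetProd L k B G) := fun i =>
    {y | (∃ a : B, (a : A) ∈ near i ∧ y = ofBase L k a) ∨
      ∃ e' : edges L k B, (∃ s, (e'.1 s : A) ∈ near i) ∧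
        ∃ z : G, z ∉ Set.range (root L k G) ∧ z ∈ nearG i e' ∧ y = ofCopy L k e' z}
  have hWD : ∀ i ≤ r + 1, W i ⊆ Config.domain D := by
    rintro i hi y (⟨a, -, rfl⟩ | ⟨e', -, z, -, hz, rfl⟩)
    · exact Or.inl ⟨a, rfl⟩
    · exact Or.inr ⟨e', z, symbNbhd_mono hi _ hz, rfl⟩
  have hedge : ∀ (e' : edges L k A) (i : ℕ) (s : Fin k), e'.1 s ∈ near i →
      ∀ s', e'.1 s' ∈ near (i + 1) := fun e' i s hs s' =>
    mem_symbNbhd_succ_of_relMap (Set.mem_insert _ _) e'.2 hs s'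
  have hfa : (f ∘ fun i => (⟨_, listed_mem_domain S (r + 1) b e x he (σ i)⟩ : domainSub D)) =
      listed b e x ∘ σ := by
    ext i
    simp only [Function.comp]
    rcases σ i with j | j <;> rfl
  rw [← hfa]
  refine (realize_iff_of_locallyFull (S := S) hφ hq f hf ?_ (fun i => {y | y.1 ∈ W i}) ?_ _ ?_ ?_).symm
  · rintro n R hR t (⟨a, ha, ht⟩ | ⟨e', z, hz, ht⟩)
    · exact Or.inl ⟨fun l => (a l : A), ha, funext fun l => congrArg (prodIncl B) (congrFun ht l)⟩
    · exact Or.inr ⟨edgeIncl B e', z, hz, funext fun l => congrArg (prodIncl B) (congrFun ht l)⟩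
  · rintro i y (⟨a, ha, h⟩ | ⟨e', ⟨s, hs⟩, z, hz, hz', h⟩)
    · exact Or.inl ⟨a, symbNbhd_subset_succ _ _ ha, h⟩
    · exact Or.inr ⟨e', ⟨s, symbNbhd_subset_succ _ _ hs⟩, z, hz, symbNbhd_subset_succ _ _ hz', h⟩
  · rintro _ ⟨i, rfl⟩
    change listed (ballTuple S (r + 1) b) (ballEdge S (r + 1) b e he) x (σ i) ∈ W 0
    rcases σ i with j | j
    · exact Or.inl ⟨_, ⟨j, rfl⟩, rfl⟩
    · exact Or.inr ⟨ballEdge S (r + 1) b e he j, ⟨⟨0, hk⟩, he j _⟩, x j, hx j,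
        Or.inr ⟨j, rfl, rfl⟩, rfl⟩
  · rintro i hi n R hR t (⟨a, ha, rfl⟩ | ⟨e', z, hz, rfl⟩) j ⟨y, hyD⟩ hy hty
    · have haj : a j ∈ near i := by
        rcases hy with ⟨a', ha', h⟩ | ⟨e', -, z, hz, -, h⟩
        · obtain rfl : y = ofBase L k a' := h
          have : a j = a' := ofBase_injective hroots hty
          rwa [this]
        · obtain rfl : y = ofCopy L k e' z := h
          obtain ⟨s, h, -⟩ := (ofBase_eq_ofCopy_iff hroots).1 hty
          exact absurd ⟨s, h.symm⟩ hz
      have hal : ∀ l, a l ∈ near (i + 1) := fun l =>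
        mem_symbNbhd_succ_of_relMap (inl_mem_baseSymbols hR) ha haj l
      have haB : ∀ l, a l ∈ B := fun l => symbNbhd_mono (by omega) _ (hal l)
      have hW : ∀ l, ofBase L k (⟨a l, haB l⟩ : B) ∈ W (i + 1) := fun l =>
        Or.inl ⟨⟨a l, haB l⟩, hal l, rfl⟩
      exact ⟨fun l => ⟨ofBase L k (⟨a l, haB l⟩ : B), hWD (i + 1) (by omega) (hW l)⟩, rfl,
        Or.inl ⟨fun l => ⟨a l, haB l⟩, ha, rfl⟩, hW⟩
    · have hej : (∃ s, e'.1 s ∈ near i) ∧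
          z j ∈ symbNbhd (gadgetSymbols k S) i (centers e x e') := by
        rcases hy with ⟨a', ha', h⟩ | ⟨e'', he'', z', hz', hz'', h⟩
        · obtain rfl : y = ofBase L k a' := h
          obtain ⟨s, h, h'⟩ := (ofBase_eq_ofCopy_iff hroots).1 hty.symm
          refine ⟨⟨s, ?_⟩, ?_⟩
          · rw [← h']; exact ha'
          -- A tuple can enter a copy at a root. This is the reason for including the roots among
          -- the centres.
          · rw [h]; exact subset_symbNbhd _ _ (Or.inl ⟨s, rfl⟩)
        · obtain rfl : y = ofCopy L k e'' z' := h
          rcases (ofCopy_eq_ofCopy_iff hroots).1 hty with ⟨rfl, h⟩ | ⟨-, s, -, h, -⟩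
          · exact ⟨he'', h ▸ hz''⟩
          · exact absurd ⟨s, h.symm⟩ hz'
      obtain ⟨⟨s, hs⟩, hzj⟩ := hej
      have heB : ∀ s', e'.1 s' ∈ B := fun s' =>
        symbNbhd_mono (by omega) _ (hedge e' i s hs s')
      let e₁ : edges L k B := ⟨fun s' => ⟨e'.1 s', heB s'⟩, e'.2⟩
      have hW : ∀ l, ofCopy L k e₁ (z l) ∈ W (i + 1) := by
        intro l
        by_cases hl : z l ∈ Set.range (root L k G)
        -- A root is placed in the next layer as an endpoint of `e'`: since `R` is a base symbol,
        -- all endpoints of an edge meeting the `i`-ball lie in the `(i + 1)`-ball.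
        · obtain ⟨s', hs'⟩ := hl
          rw [← hs', ofCopy_root]
          exact Or.inl ⟨_, hedge e' i s hs s', rfl⟩
        · exact Or.inr ⟨e₁, ⟨s, symbNbhd_subset_succ _ _ hs⟩, z l, hl,
            mem_symbNbhd_succ_of_relMap (inl_mem_gadgetSymbols hR) hz hzj l, rfl⟩
      exact ⟨fun l => ⟨ofCopy L k e₁ (z l), hWD (i + 1) (by omega) (hW l)⟩, rfl,
        Or.inr ⟨e₁, z, hz, rfl⟩, hW⟩

theorem rankType_domainSub (S : Set (Σ n, L.Relations n)) (q : ℕ) (D : edges L k A → Set G)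
    (a : α → domainSub D) : rankType S Set.univ q a =
      rankType S (Config.domain D) q (fun i => (a i : GadgetProd L k A G)) := by
  rw [rankType_map (S := S) ((↑) : domainSub D → GadgetProd L k A G) Subtype.val_injective
    (fun _ _ _ _ => Iff.rfl), Set.image_univ, Subtype.range_coe]
  rfl

theorem rankType_ballTuple (S : Set (Σ n, L.Relations n)) (r q : ℕ) (b : β → A) :
    rankType (baseSymbols k S) Set.univ q (ballTuple (k := k) S r b) =
      rankType (baseSymbols k S) (symbNbhd (baseSymbols k S) r (Set.range b)) q b := by
  rw [rankType_map (S := baseSymbols k S) ((↑) : ball (k := k) S r b → A) Subtype.val_injective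
    (fun _ _ _ _ => Iff.rfl), Set.image_univ, Subtype.range_coe]
  rfl

end Restriction

/-! ### Tuples with a given profile -/

namespace Profile

variable {p : ℕ} (π : Profile p)

/-- The indices of the external vertices. -/
abbrev Outer : Type := {i : Fin p // i ∉ π.I}

/-- The blocks of a profile. -/
abbrev Block : Type := {E : Finset (Fin p) // E ∈ π.blocks.parts}

variable {π}

theorem notMem_of_mem_block (E : π.Block) {i : Fin p} (hi : i ∈ E.1) : i ∉ π.I :=
  Finset.mem_compl.1 (π.blocks.le E.2 hi)

/-- The inclusion of a block. -/
def blockIncl (E : π.Block) (i : {i // i ∈ E.1}) : π.Outer := ⟨i.1, notMem_of_mem_block E i.2⟩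

/-- The block of an index. -/
def blockOf (i : π.Outer) : π.Block :=
  ⟨π.blocks.part i.1, π.blocks.part_mem.2 (Finset.mem_compl.2 i.2)⟩

theorem mem_blockOf (i : π.Outer) : i.1 ∈ (blockOf i).1 :=
  π.blocks.mem_part (Finset.mem_compl.2 i.2)

/-- An index in a block. -/
def blockRep (E : π.Block) : π.Outer :=
  blockIncl E ⟨_, (π.blocks.nonempty_of_mem_parts E.2).choose_spec⟩

theorem blockRep_mem (E : π.Block) : (blockRep E).1 ∈ E.1 :=
  (π.blocks.nonempty_of_mem_parts E.2).choose_spec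

theorem block_ext {E E' : π.Block} {i : Fin p} (h : i ∈ E.1) (h' : i ∈ E'.1) : E = E' :=
  Subtype.ext (π.blocks.eq_of_mem_parts E.2 E'.2 h h')

theorem sameBlock_iff_mem {E : π.Block} {i j : Fin p} (hi : i ∈ E.1) :
    π.SameBlock i j ↔ j ∈ E.1 := by
  constructor
  · rintro ⟨E', hE', h, h'⟩
    rwa [block_ext (E := E) (E' := ⟨E', hE'⟩) hi h]
  · exact fun hj => ⟨E.1, E.2, hi, hj⟩

theorem sameBlock_iff_blockOf_eq {i j : π.Outer} :
    π.SameBlock i.1 j.1 ↔ blockOf i = blockOf j := by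
  rw [sameBlock_iff_mem (mem_blockOf i)]
  exact ⟨fun h => block_ext h (mem_blockOf j), fun h => h ▸ mem_blockOf j⟩

end Profile

open Profile

/-- The type of a tuple of the base structure in its neighbourhood. -/
def baseType {L : FirstOrder.Language.{v, w}} (k : ℕ) {A : Type u} [(baseLang L k).Structure A]
    (S : Set (Σ n, L.Relations n)) (r q : ℕ) {β : Type} (b : β → A) : RankType (baseSymbols k S) q β :=
  rankType (baseSymbols k S) (symbNbhd (baseSymbols k S) r (Set.range b)) q b

/-- The type of a tuple of a gadget and the roots in their neighbourhood. -/
def copyType {L : FirstOrder.Language.{v, w}} (k : ℕ) {G : Type u} [(gadgetLang L k).Structure G]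
    (S : Set (Σ n, L.Relations n)) (r q : ℕ) {α : Type} (x : α → G) : RankType (gadgetSymbols k S) q (Fin k ⊕ α) :=
  rankType (gadgetSymbols k S) (symbNbhd (gadgetSymbols k S) r (Set.range (withRoots L k x))) q
    (withRoots L k x)

section ProfileTuple

variable {L : FirstOrder.Language.{v, w}} {k p : ℕ} {π : Profile p} {A G : Type u}
  [(baseLang L k).Structure A] [(gadgetLang L k).Structure G]

/-- The edges of a representation. -/
def repEdge {b : RepVar k π → A} (hb : IsRep L k π b) (i : π.Outer) : edges L k A :=
  ⟨edgeBlock b i, (hb i).1⟩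

theorem repEdge_eq_iff {b : RepVar k π → A} (hb : IsRep L k π b) (i j : π.Outer) :
    repEdge hb i = repEdge hb j ↔ π.SameBlock i.1 j.1 :=
  Subtype.ext_iff.trans ((hb i).2 j)

theorem repEdge_mem_range {b : RepVar k π → A} (hb : IsRep L k π b) (i : π.Outer) (s : Fin k) :
    (repEdge hb i).1 s ∈ Set.range b := ⟨Sum.inr (i, s), rfl⟩

/-- The position of an index among the internal vertices or the external vertices. -/
def profileIndex (k : ℕ) (π : Profile p) (i : Fin p) : RepVar k π ⊕ π.Outer :=
  if h : i ∈ π.I then Sum.inl (Sum.inl ⟨i, h⟩) else Sum.inr ⟨i, h⟩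

/-- The tuple of vertices of `A * G` with a given representation and given vertices of the
gadget. -/
def profileTuple {b : RepVar k π → A} (hb : IsRep L k π b) (x : π.Outer → G) :
    Fin p → GadgetProd L k A G :=
  listed b (repEdge hb) x ∘ profileIndex k π

theorem centers_repEdge {b : RepVar k π → A} (hb : IsRep L k π b) (x : π.Outer → G) (E : π.Block) :
    centers (repEdge hb) x (repEdge hb (blockRep E)) =
      Set.range (withRoots L k (x ∘ blockIncl E)) := by
  ext y
  constructor
  · rintro (⟨i, rfl⟩ | ⟨i, hi, rfl⟩)
    · exact ⟨Sum.inl i, rfl⟩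
    · rw [eq_comm, repEdge_eq_iff, sameBlock_iff_mem (blockRep_mem E)] at hi
      exact ⟨Sum.inr ⟨i.1, hi⟩, rfl⟩
  · rintro ⟨i | i, rfl⟩
    · exact Or.inl ⟨i, rfl⟩
    · refine Or.inr ⟨blockIncl E i, ?_, rfl⟩
      rw [eq_comm, repEdge_eq_iff, sameBlock_iff_mem (blockRep_mem E)]
      exact i.2

/-- On an edge not belonging to a block only the roots are centres, so all such copies are cut down
to the same set, as `Matches` demands. -/
theorem centers_of_ne {b : RepVar k π → A} (hb : IsRep L k π b) (x : π.Outer → G)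
    {e : edges L k A} (he : ∀ E : π.Block, repEdge hb (blockRep E) ≠ e) :
    centers (repEdge hb) x e = Set.range (root L k G) := by
  refine Set.union_eq_self_of_subset_right ?_
  rintro _ ⟨i, rfl, -⟩
  refine absurd ?_ (he (blockOf i))
  rw [repEdge_eq_iff, sameBlock_iff_mem (blockRep_mem _)]
  exact mem_blockOf i

variable [L.IsRelational] (S : Set (Σ n, L.Relations n))

/-- The distinguished edges are those of the blocks. -/
abbrev blockIndex (k : ℕ) (π : Profile p) (E : π.Block) (s : Fin k) : RepVar k π :=
  Sum.inr (blockRep E, s)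

open Classical in
/-- The configuration of a representation, in a neighbourhood in the base structure. -/
def profileConfig (r : ℕ) {b : RepVar k π → A} (hb : IsRep L k π b) (i₀ : Fin k)
    (x : π.Outer → G) : Config L (ball (k := k) S r b) G π.Outer (blockIndex k π) where
  base := ballTuple S r b
  edge E := ballEdge S r b (repEdge hb) (repEdge_mem_range hb) (blockRep E)
  -- A configuration uses one index type for all copies, so indices outside the block are padded
  -- with a root.
  copy E i := if i.1 ∈ E.1 then x i else root L k G i₀
  edge_injective E E' h := by
    have h : repEdge hb (blockRep E) = repEdge hb (blockRep E') := congrArg (edgeIncl _) h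
    rw [repEdge_eq_iff, sameBlock_iff_mem (blockRep_mem E)] at h
    exact block_ext h (blockRep_mem E')
  edge_eq _ _ := rfl

-- The padding repeats a root already listed, so it carries no information beyond the type of the
-- block with the roots.
open Classical in
theorem withRoots_profileConfig_copy (r : ℕ) {b : RepVar k π → A} (hb : IsRep L k π b) (i₀ : Fin k)
    (x : π.Outer → G) (E : π.Block) :
    withRoots L k ((profileConfig S r hb i₀ x).copy E) = withRoots L k (x ∘ blockIncl E) ∘
      Sum.elim Sum.inl (fun i => if h : i.1 ∈ E.1 then Sum.inr ⟨i.1, h⟩ else Sum.inl i₀) := by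
  ext i
  rcases i with i | i
  · rfl
  · simp only [withRoots, profileConfig, Sum.elim_inr, Function.comp]
    split_ifs <;> rfl

theorem listed_ball_eq (r : ℕ) {b : RepVar k π → A} (hb : IsRep L k π b) (i₀ : Fin k)
    (x : π.Outer → G) :
    listed (ballTuple (k := k) S r b) (ballEdge S r b (repEdge hb) (repEdge_mem_range hb)) x =
      (profileConfig S r hb i₀ x).tuple ∘
        Sum.map id (fun i => (blockOf i, Sum.inr i)) := by
  ext i
  rcases i with i | i
  · rfl
  · have h1 : repEdge hb i = repEdge hb (blockRep (blockOf i)) := by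
      rw [eq_comm, repEdge_eq_iff, sameBlock_iff_mem (blockRep_mem _)]
      exact mem_blockOf i
    have h2 := edgeIncl_injective (ball (k := k) S r b)
      (a₁ := ballEdge S r b (repEdge hb) (repEdge_mem_range hb) i)
      (a₂ := ballEdge S r b (repEdge hb) (repEdge_mem_range hb) (blockRep (blockOf i))) h1
    simp only [listed, Config.tuple, profileConfig, withRoots, Function.comp, Sum.map_inr,
      Sum.elim_inr, if_pos (mem_blockOf i), h2]

variable {A' G' : Type u} [(baseLang L k).Structure A'] [(gadgetLang L k).Structure G']

theorem profileConfig_matches {S : Set (Σ n, L.Relations n)} {r q : ℕ} {b : RepVar k π → A}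
    (hb : IsRep L k π b) {b' : RepVar k π → A'} (hb' : IsRep L k π b') (i₀ : Fin k) {x : π.Outer → G}
    {x' : π.Outer → G'} (hbase : baseType k S r q b = baseType k S r q b')
    (hcopy : ∀ E : π.Block, copyType k S r q (x ∘ blockIncl E) = copyType k S r q (x' ∘ blockIncl E))
    (hrest : copyType k S r q (Empty.elim : Empty → G) = copyType k S r q (Empty.elim : Empty → G')) :
    Matches S q (copyBalls S r (repEdge hb) x _)
      (symbNbhd (gadgetSymbols k S) r (Set.range (root L k G)))
      (copyBalls S r (repEdge hb') x' _)
      (symbNbhd (gadgetSymbols k S) r (Set.range (root L k G')))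
      (profileConfig S r hb i₀ x) (profileConfig S r hb' i₀ x') where
  base := by
    refine (rankType_ballTuple S r q b).trans (hbase.trans (rankType_ballTuple S r q b').symm)
  copy E := by
    rw [withRoots_profileConfig_copy, withRoots_profileConfig_copy]
    refine rankType_reindex ?_ _
    have key : ∀ {A G : Type u} [(baseLang L k).Structure A] [(gadgetLang L k).Structure G]
        {b : RepVar k π → A} (hb : IsRep L k π b) (x : π.Outer → G),
        copyBalls S r (repEdge hb) x (ball S r b) ((profileConfig S r hb i₀ x).edge E) =
          symbNbhd (gadgetSymbols k S) r (Set.range (withRoots L k (x ∘ blockIncl E))) :=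
      fun hb x => congrArg _ (centers_repEdge hb x E)
    rw [key, key]
    exact hcopy E
  rest := by
    have key : ∀ (G : Type u) [(gadgetLang L k).Structure G],
        Set.range (withRoots L k (Empty.elim : Empty → G)) = Set.range (root L k G) := by
      intro G _
      exact (Set.Sum.elim_range _ _).trans (by simp [Set.range_eq_empty])
    simp only [copyType, key] at hrest
    exact rankType_reindex hrest Sum.inl
  left e he := congrArg _ (centers_of_ne hb x fun E h => he E (edgeIncl_injective _ h))
  right e he := congrArg _ (centers_of_ne hb' x' fun E h => he E (edgeIncl_injective _ h))

/-- The truth of a local formula in a gadget product is determined by types of the parts. -/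
theorem realize_profileTuple_iff [IsEmpty (L.Relations 0)] (hk : 0 < k) [Finite A] [Finite G]
    [Finite A'] [Finite G'] (hG : Function.Injective (root L k G))
    (hG' : Function.Injective (root L k G')) {φ : L.Formula (Fin p)} {r : ℕ}
    (hφ : IsLocalAt.{u} r φ) {S : Set (Σ n, L.Relations n)} {q : ℕ}
    (hq : ∀ (M N : Type u) [L.Structure M] [L.Structure N] (x : Fin p → M) (y : Fin p → N),
      rankType S Set.univ q x = rankType S Set.univ q y → (φ.Realize x ↔ φ.Realize y))
    {b : RepVar k π → A} (hb : IsRep L k π b) {b' : RepVar k π → A'} (hb' : IsRep L k π b')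
    {x : π.Outer → G} (hx : ∀ i, x i ∉ Set.range (root L k G))
    {x' : π.Outer → G'} (hx' : ∀ i, x' i ∉ Set.range (root L k G'))
    (hbase : baseType k S (r + 1) (q * (k + 1) + k) b = baseType k S (r + 1) (q * (k + 1) + k) b')
    (hcopy : ∀ E : π.Block, copyType k S (r + 1) (q * (k + 1) + k) (x ∘ blockIncl E) =
      copyType k S (r + 1) (q * (k + 1) + k) (x' ∘ blockIncl E))
    (hrest : copyType k S (r + 1) (q * (k + 1) + k) (Empty.elim : Empty → G) =
      copyType k S (r + 1) (q * (k + 1) + k) (Empty.elim : Empty → G')) :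
    φ.Realize (profileTuple hb x) ↔ φ.Realize (profileTuple hb' x') := by
  have h := determinesRank hk S q _ _ _ _ hG hG' _ _ _ _ _ _ _ _ _ _
    (profileConfig_matches hb hb' ⟨0, hk⟩ hbase hcopy hrest)
  have h := rankType_reindex h (Sum.map id (fun i => (blockOf i, Sum.inr i)) ∘ profileIndex k π)
  rw [← Function.comp_assoc, ← Function.comp_assoc, ← listed_ball_eq, ← listed_ball_eq] at h
  rw [profileTuple, profileTuple,
    realize_iff_realize_domainSub hk hG hφ hq b (repEdge hb) x (repEdge_mem_range hb) hx,
    realize_iff_realize_domainSub hk hG' hφ hq b' (repEdge hb') x' (repEdge_mem_range hb') hx']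
  apply hq
  rw [rankType_domainSub, rankType_domainSub]
  exact h

end ProfileTuple

/-! ### Profiles and their representations -/

namespace Profile

variable {p : ℕ}

theorem sameBlock_iff_mem_part {π : Profile p} {i j : Fin p} :
    π.SameBlock i j ↔ j ∈ π.blocks.part i := by
  rw [Finpartition.mem_part_iff_exists]
  exact exists_congr fun E => and_congr_right fun _ => and_comm

theorem sameBlock_iff_part_eq {π : Profile p} {i j : Fin p} (hi : i ∉ π.I) (hj : j ∉ π.I) :
    π.SameBlock i j ↔ π.blocks.part i = π.blocks.part j :=
  sameBlock_iff_mem_part.trans <| (π.blocks.mem_part_iff_part_eq_part (Finset.mem_compl.2 hj)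
    (Finset.mem_compl.2 hi)).trans eq_comm

theorem ext_of_sameBlock {π π' : Profile p} (hI : π.I = π'.I)
    (h : ∀ i j, i ∉ π.I → j ∉ π.I → (π.SameBlock i j ↔ π'.SameBlock i j)) : π = π' := by
  have hpart : ∀ i, i ∉ π.I → π.blocks.part i = π'.blocks.part i := by
    intro i hi
    ext j
    by_cases hj : j ∈ π.I
    · exact iff_of_false (fun h => Finset.mem_compl.1 (π.blocks.part_subset i h) hj)
        (fun h => Finset.mem_compl.1 (π'.blocks.part_subset i h) (hI ▸ hj))
    · rw [← sameBlock_iff_mem_part, ← sameBlock_iff_mem_part, h i j hi hj]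
  obtain ⟨I, P⟩ := π
  obtain ⟨I', P'⟩ := π'
  obtain rfl : I = I' := hI
  congr 1
  have key : ∀ {P P' : Finpartition Iᶜ}, (∀ i, i ∉ I → P.part i = P'.part i) →
      P.parts ⊆ P'.parts := by
    intro P P' h E hE
    obtain ⟨i, hi⟩ := P.nonempty_of_mem_parts hE
    have hiI := P.le hE hi
    rw [← P.part_eq_of_mem hE hi, h i (Finset.mem_compl.1 hiI)]
    exact P'.part_mem.2 hiI
  exact Finpartition.ext ((key hpart).antisymm (key fun i hi => (hpart i hi).symm))

open Classical in
/-- The profile with internal indices `I` and blocks the classes of an equivalence relation. -/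
def ofSetoid (I : Finset (Fin p)) (s : Setoid (Fin p)) : Profile p :=
  ⟨I, Finpartition.ofSetSetoid s Iᶜ⟩

theorem ofSetoid_sameBlock_iff {I : Finset (Fin p)} {s : Setoid (Fin p)} {i j : Fin p}
    (hi : i ∉ I) (hj : j ∉ I) : (ofSetoid I s).SameBlock i j ↔ s i j := by
  classical
  rw [sameBlock_iff_mem_part]
  refine (Finpartition.mem_part_ofSetSetoid_iff_rel _).trans ?_
  exact ⟨fun h => h.2.2, fun h => ⟨Finset.mem_compl.2 hi, Finset.mem_compl.2 hj, h⟩⟩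

theorem card_block_le (π : Profile p) : Nat.card π.Block ≤ Nat.card π.Outer := by
  refine Nat.card_le_card_of_injective blockRep fun E E' h => ?_
  exact block_ext (blockRep_mem E) (h ▸ blockRep_mem E')

instance : Finite (Profile p) :=
  Finite.of_injective (β := Finset (Fin p) × (Fin p → Fin p → Prop))
    (fun π => (π.I, π.SameBlock)) fun π π' h => by
      obtain ⟨h1, h2⟩ := Prod.ext_iff.1 h
      exact ext_of_sameBlock h1 fun i j _ _ => iff_of_eq (congrFun (congrFun h2 i) j)

end Profile

open Profile

section Representation

variable {L : FirstOrder.Language.{v, w}} {k p : ℕ} {A G : Type u}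
  [(baseLang L k).Structure A] [(gadgetLang L k).Structure G]

theorem HasProfile.unique {π π' : Profile p} {a : Fin p → GadgetProd L k A G}
    (h : HasProfile L k π a) (h' : HasProfile L k π' a) : π = π' := by
  have hI : π.I = π'.I := by
    ext i
    rw [h.1, h'.1]
  exact Profile.ext_of_sameBlock hI fun i j hi hj =>
    (h.2 i j hi hj).symm.trans (h'.2 i j (hI ▸ hi) (hI ▸ hj))

theorem exists_ofCopy_of_not_isInternal {y : GadgetProd L k A G} (h : ¬ IsInternal L k y) :
    ∃ (e : edges L k A) (x : NonRoot L k G), y = ofCopy L k e x.1 := by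
  induction y using Quot.ind with
  | mk y =>
    rcases y with a | ⟨e, x⟩
    · exact absurd ⟨a, rfl⟩ h
    · refine ⟨e, ⟨x, ?_⟩, rfl⟩
      rintro ⟨i, rfl⟩
      exact h ⟨e.1 i, ofCopy_root e i⟩

variable (hroots : Function.Injective (root L k G))
include hroots

theorem exists_hasProfile (a : Fin p → GadgetProd L k A G) : ∃ π : Profile p, HasProfile L k π a := by
  classical
  let I : Finset (Fin p) := Finset.univ.filter fun i => IsInternal L k (a i)
  have hI : ∀ i, i ∈ I ↔ IsInternal L k (a i) := by simp [I]
  refine ⟨Profile.ofSetoid I (Setoid.ker fun i => {e | InCopy L k (a i) e}), hI, ?_⟩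
  intro i j hi hj
  refine Iff.trans ?_ (Profile.ofSetoid_sameBlock_iff hi hj).symm
  obtain ⟨e, x, hx⟩ := exists_ofCopy_of_not_isInternal ((hI i).not.1 hi)
  obtain ⟨e', x', hx'⟩ := exists_ofCopy_of_not_isInternal ((hI j).not.1 hj)
  simp only [Setoid.ker_def, hx, hx', inCopy_ofCopy_iff hroots x.2, inCopy_ofCopy_iff hroots x'.2]
  simp [eq_comm]

variable {π : Profile p}

theorem profileTuple_hasProfile {b : RepVar k π → A} (hb : IsRep L k π b)
    (x : π.Outer → NonRoot L k G) :
    HasProfile L k π (profileTuple hb fun i => (x i).1) := by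
  have h1 : ∀ i, ∀ hi : i ∉ π.I, profileTuple hb (fun i => (x i).1) i =
      ofCopy L k (repEdge hb ⟨i, hi⟩) (x ⟨i, hi⟩).1 := by
    intro i hi
    simp [profileTuple, profileIndex, hi, listed]
  constructor
  · intro i
    by_cases hi : i ∈ π.I
    · refine iff_of_true hi ⟨b (Sum.inl ⟨i, hi⟩), ?_⟩
      simp [profileTuple, profileIndex, hi, listed]
    · refine iff_of_false hi ?_
      rw [h1 i hi, isInternal_ofCopy_iff hroots]
      exact (x _).2
  · intro i j hi hj
    simp only [h1 i hi, h1 j hj, inCopy_ofCopy_iff hroots (x _).2]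
    rw [← repEdge_eq_iff hb ⟨i, hi⟩ ⟨j, hj⟩]
    simp [eq_comm]

/-- The tuples with profile `π` are given by the representations in the base structure and the
non-root vertices of the gadget. -/
def profileEquiv (π : Profile p) :
    {b : RepVar k π → A // IsRep L k π b} × (π.Outer → NonRoot L k G) ≃
      {a : Fin p → GadgetProd L k A G // HasProfile L k π a} :=
  _root_.Equiv.ofBijective
    (fun bx => ⟨profileTuple bx.1.2 fun i => (bx.2 i).1, profileTuple_hasProfile hroots bx.1.2 bx.2⟩) (by
      constructor
      · rintro ⟨⟨b, hb⟩, x⟩ ⟨⟨b', hb'⟩, x'⟩ h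
        have h : ∀ i, profileTuple hb (fun i => (x i).1) i = profileTuple hb' (fun i => (x' i).1) i :=
          fun i => congrFun (congrArg Subtype.val h) i
        have h1 : ∀ i : {i // i ∈ π.I}, b (Sum.inl i) = b' (Sum.inl i) := by
          rintro ⟨i, hi⟩
          have := h i
          simp only [profileTuple, profileIndex, hi, listed, Function.comp, dif_pos,
            Sum.elim_inl] at this
          exact ofBase_injective hroots this
        have h2 : ∀ i : π.Outer, repEdge hb i = repEdge hb' i ∧ x i = x' i := by
          rintro ⟨i, hi⟩
          have := h i
          simp only [profileTuple, profileIndex, hi, listed, Function.comp, dif_neg,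
            not_false_eq_true, Sum.elim_inr] at this
          rcases (ofCopy_eq_ofCopy_iff hroots).1 this with ⟨e1, e2⟩ | ⟨s, -, e, -, -⟩
          · exact ⟨e1, Subtype.ext e2⟩
          · exact absurd ⟨s, e.symm⟩ (x _).2
        refine Prod.ext (Subtype.ext (funext ?_)) (funext fun i => (h2 i).2)
        rintro (i | ⟨i, s⟩)
        · exact h1 i
        · exact congrFun (congrArg Subtype.val (h2 i).1) s
      · rintro ⟨a, ha⟩
        have h1 : ∀ i : {i // i ∈ π.I}, ∃ y : A, a i.1 = ofBase L k y := fun i => (ha.1 i.1).1 i.2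
        have h2 : ∀ i : π.Outer, ∃ (e : edges L k A) (x : NonRoot L k G),
            a i.1 = ofCopy L k e x.1 := fun i =>
          exists_ofCopy_of_not_isInternal ((ha.1 i.1).not.1 i.2)
        choose y hy using h1
        choose e x hx using h2
        let b : RepVar k π → A := Sum.elim y fun is => (e is.1).1 is.2
        have hb : IsRep L k π b := by
          intro i
          refine ⟨(e i).2, fun j => ?_⟩
          rw [← ha.2 i.1 j.1 i.2 j.2]
          simp only [hx, inCopy_ofCopy_iff hroots (x _).2]
          have : edgeBlock b i = edgeBlock b j ↔ e i = e j :=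
            ⟨fun h => Subtype.ext h, fun h => congrArg Subtype.val h⟩
          rw [this]
          simp [eq_comm]
        refine ⟨⟨⟨b, hb⟩, x⟩, Subtype.ext (funext fun i => ?_)⟩
        by_cases hi : i ∈ π.I
        · refine Eq.trans ?_ (hy ⟨i, hi⟩).symm
          simp [profileTuple, profileIndex, hi, listed, b]
        · refine Eq.trans ?_ (hx ⟨i, hi⟩).symm
          simp only [profileTuple, profileIndex, hi, listed, Function.comp, dif_neg,
            not_false_eq_true, Sum.elim_inr]
          rfl)

omit hroots

/-- A representation consists of vertices for the internal indices and distinct edges for the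
blocks. -/
def repEquiv (L : FirstOrder.Language.{v, w}) (k : ℕ) (A : Type u) [(baseLang L k).Structure A]
    (π : Profile p) :
    {b : RepVar k π → A // IsRep L k π b} ≃ ({i // i ∈ π.I} → A) × (π.Block ↪ edges L k A) where
  toFun b := (fun i => b.1 (Sum.inl i), ⟨fun E => repEdge b.2 (blockRep E), fun E E' h => by
    rw [repEdge_eq_iff, sameBlock_iff_mem (blockRep_mem E)] at h
    exact block_ext h (blockRep_mem E')⟩)
  invFun ye := ⟨Sum.elim ye.1 fun is => (ye.2 (blockOf is.1)).1 is.2, fun i =>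
    ⟨(ye.2 (blockOf i)).2, fun _ => Subtype.ext_iff.symm.trans
      (ye.2.injective.eq_iff.trans sameBlock_iff_blockOf_eq.symm)⟩⟩
  left_inv := by
    rintro ⟨b, hb⟩
    refine Subtype.ext (funext ?_)
    rintro (i | ⟨i, s⟩)
    · rfl
    · have : repEdge hb (blockRep (blockOf i)) = repEdge hb i := by
        rw [repEdge_eq_iff, sameBlock_iff_mem (blockRep_mem _)]
        exact mem_blockOf i
      exact congrFun (congrArg Subtype.val this) s
  right_inv := by
    rintro ⟨y, e⟩
    refine Prod.ext rfl (Function.Embedding.ext fun E => ?_)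
    have : blockOf (blockRep E) = E := block_ext (mem_blockOf _) (blockRep_mem E)
    exact congrArg e this

end Representation

/-! ### Convergent sequences of reals -/

section Converges

theorem Converges.const (l : ℝ) : Converges fun _ => l := ⟨l, tendsto_const_nhds⟩

theorem Converges.mul {x y : ℕ → ℝ} (hx : Converges x) (hy : Converges y) :
    Converges fun n => x n * y n := by
  obtain ⟨a, ha⟩ := hx
  obtain ⟨b, hb⟩ := hy
  exact ⟨a * b, ha.mul hb⟩

theorem Converges.sum {ι : Type*} {s : Finset ι} {x : ι → ℕ → ℝ} (hx : ∀ i, Converges (x i)) :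
    Converges fun n => ∑ i ∈ s, x i n := by
  choose a ha using hx
  exact ⟨_, tendsto_finsetSum s fun i _ => ha i⟩

theorem Converges.prod {ι : Type*} {s : Finset ι} {x : ι → ℕ → ℝ} (hx : ∀ i, Converges (x i)) :
    Converges fun n => ∏ i ∈ s, x i n := by
  choose a ha using hx
  exact ⟨_, tendsto_finsetProd s fun i _ => ha i⟩

/-- The quotient is a product of `t` factors `(N - i) / N`, each tending to `1`. -/
theorem tendsto_descFactorial_div_pow (t : ℕ) :
    Tendsto (fun N : ℕ => (N.descFactorial t : ℝ) / (N : ℝ) ^ t) atTop (𝓝 1) := by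
  induction t with
  | zero => simp
  | succ t ih =>
    have h1 : Tendsto (fun N : ℕ => ((N - t : ℕ) : ℝ) / N) atTop (𝓝 1) := by
      have h2 : Tendsto (fun N : ℕ => 1 - (t : ℝ) / N) atTop (𝓝 (1 - 0)) :=
        tendsto_const_nhds.sub (tendsto_const_div_atTop_nhds_zero_nat _)
      rw [sub_zero] at h2
      refine h2.congr' ?_
      filter_upwards [eventually_ge_atTop (t + 1)] with N hN
      have : (N : ℝ) ≠ 0 := by
        have : N ≠ 0 := by omega
        exact_mod_cast this
      rw [Nat.cast_sub (by omega)]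
      field_simp
    have := h1.mul ih
    rw [one_mul] at this
    refine this.congr fun N => ?_
    rw [Nat.descFactorial_succ, div_mul_div_comm, pow_succ']
    push_cast
    rfl

/-- When `N` tends to infinity the limit is `1` for `t = s` and `0` for `t < s`: coincidences among
random edges become negligible. -/
theorem converges_descFactorial_div_pow {t s : ℕ} (hts : t ≤ s) {N : ℕ → ℕ}
    (hN : (∃ r : ℕ, ∀ᶠ n in atTop, N n = r) ∨ Tendsto N atTop atTop) :
    Converges fun n => ((N n).descFactorial t : ℝ) / (N n : ℝ) ^ s := by
  rcases hN with ⟨r, hr⟩ | hN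
  · refine ⟨(r.descFactorial t : ℝ) / (r : ℝ) ^ s, tendsto_const_nhds.congr' ?_⟩
    filter_upwards [hr] with n hn
    rw [hn]
  · have h1 := (tendsto_descFactorial_div_pow t).comp hN
    have h2 := ((tendsto_const_div_atTop_nhds_zero_nat (𝕜 := ℝ) 1).pow (s - t)).comp hN
    refine ⟨_, (h1.mul h2).congr fun n => ?_⟩
    simp only [Function.comp, div_pow, one_pow]
    rw [div_mul_div_comm, mul_one, ← pow_add, Nat.add_sub_cancel' hts]

theorem descFactorial_div_pow_le_one {t s : ℕ} (hts : t ≤ s) (N : ℕ) :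
    (N.descFactorial t : ℝ) / (N : ℝ) ^ s ≤ 1 := by
  rcases Nat.eq_zero_or_pos N with rfl | hN
  · rcases Nat.eq_zero_or_pos s with rfl | hs
    · obtain rfl : t = 0 := by omega
      simp
    · simp [hs.ne']
  · refine div_le_one_of_le₀ ?_ (by positivity)
    exact_mod_cast (Nat.descFactorial_le_pow N t).trans (Nat.pow_le_pow_right hN hts)

end Converges

/-! ### Counting -/

section Counting

theorem card_subtype_eq_sum {X ι : Type*} [Finite X] [Fintype ι] (P : X → Prop) (Q : ι → X → Prop)
    (h : ∀ x, ∃! i, Q i x) :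
    Nat.card {x // P x} = ∑ i, Nat.card {x // Q i x ∧ P x} := by
  rw [← Nat.card_sigma]
  choose f hf hf' using h
  exact Nat.card_congr
    { toFun := fun x => ⟨f x.1, x.1, hf x.1, x.2⟩
      invFun := fun x => ⟨x.2.1, x.2.2.2⟩
      left_inv := fun _ => rfl
      right_inv := by
        rintro ⟨i, x, hx, hP⟩
        obtain rfl := hf' x i hx
        rfl }

variable {L : FirstOrder.Language.{v, w}} {k p : ℕ} {A G : Type u}
  [(baseLang L k).Structure A] [(gadgetLang L k).Structure G]

open Profile

/-- Functions on the outer indices are families of functions on the blocks. -/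
def outerFunEquiv {X : Type*} {π : Profile p} (P : ∀ E : π.Block, ({i // i ∈ E.1} → X) → Prop) :
    {x : π.Outer → X // ∀ E, P E (x ∘ blockIncl E)} ≃
      ∀ E : π.Block, {x : {i // i ∈ E.1} → X // P E x} := by
  have key : ∀ (y : ∀ E : π.Block, {x : {i // i ∈ E.1} → X // P E x}) (E : π.Block),
      (fun i : π.Outer => (y (blockOf i)).1 ⟨i.1, mem_blockOf i⟩) ∘ blockIncl E = (y E).1 := by
    intro y E
    ext i
    have : ∀ E' : π.Block, E' = E → ∀ hi : i.1 ∈ E'.1, (y E').1 ⟨i.1, hi⟩ = (y E).1 i := by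
      rintro _ rfl _
      rfl
    exact this _ (block_ext (mem_blockOf _) i.2) _
  exact
    { toFun := fun x E => ⟨x.1 ∘ blockIncl E, x.2 E⟩
      invFun := fun y => ⟨fun i => (y (blockOf i)).1 ⟨i.1, mem_blockOf i⟩, fun E => by
        rw [key]; exact (y E).2⟩
      left_inv := fun _ => rfl
      right_inv := fun y => funext fun E => Subtype.ext (key y E) }

theorem card_nonRoot_add [Finite G] (hroots : Function.Injective (root L k G)) :
    Nat.card (NonRoot L k G) + k = Nat.card G := by
  classical
  have h := Nat.card_congr (_root_.Equiv.sumCompl fun x : G => x ∈ Set.range (root L k G))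
  rw [Nat.card_sum] at h
  have h2 : Nat.card (Set.range (root L k G)) = k := by
    rw [Nat.card_range_of_injective hroots, Nat.card_fin]
  rw [← h, add_comm]
  congr 1
  exact h2.symm

theorem internalProportion_eq [Finite A] [Finite G] (hroots : Function.Injective (root L k G)) :
    internalProportion L k A G = (Nat.card A : ℝ) /
      (Nat.card A + Nat.card (edges L k A) * Nat.card (NonRoot L k G)) := by
  rw [internalProportion, Nat.card_congr (vertexEquiv (A := A) hroots), Nat.card_sum, Nat.card_prod]
  push_cast
  congr 2
  exact Nat.card_congr (_root_.Equiv.ofBijective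
    (fun a : A => (⟨ofBase L k a, a, rfl⟩ : {y : GadgetProd L k A G // IsInternal L k y}))
    ⟨fun a b h => ofBase_injective hroots (congrArg Subtype.val h),
      fun ⟨y, a, h⟩ => ⟨a, Subtype.ext h.symm⟩⟩).symm

theorem card_hasProfile (hroots : Function.Injective (root L k G)) (π : Profile p) :
    Nat.card {a : Fin p → GadgetProd L k A G // HasProfile L k π a} =
      Nat.card {b : RepVar k π → A // IsRep L k π b} * Nat.card (π.Outer → NonRoot L k G) := by
  rw [← Nat.card_prod]
  exact Nat.card_congr (profileEquiv hroots π).symm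

theorem card_isRep [Finite A] (π : Profile p) :
    Nat.card {b : RepVar k π → A // IsRep L k π b} =
      Nat.card A ^ Nat.card {i // i ∈ π.I} *
        (Nat.card (edges L k A)).descFactorial (Nat.card π.Block) := by
  have := Fintype.ofFinite (edges L k A)
  rw [Nat.card_congr (repEquiv L k A π), Nat.card_prod, Nat.card_fun, Nat.card_eq_fintype_card
    (α := π.Block ↪ _), Fintype.card_embedding_eq, Nat.card_eq_fintype_card (α := edges L k A),
    Nat.card_eq_fintype_card (α := π.Block)]

theorem card_internal_add_card_outer (π : Profile p) :
    Nat.card {i // i ∈ π.I} + Nat.card π.Outer = p := by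
  rw [← Nat.card_sum, Nat.card_congr (_root_.Equiv.sumCompl fun i => i ∈ π.I), Nat.card_fin]

/-- The edges of independent random external vertices are independent and uniform. Given which
indices are external, the prescribed pattern of coincidences thus means choosing distinct edges for
the blocks. -/
theorem profileProb_eq [Finite A] [Nonempty A] [Finite G]
    (hroots : Function.Injective (root L k G)) (π : Profile p) :
    profileProb L k π A G = internalProportion L k A G ^ Nat.card {i // i ∈ π.I} *
      (1 - internalProportion L k A G) ^ Nat.card π.Outer *
      ((Nat.card (edges L k A)).descFactorial (Nat.card π.Block) /
        (Nat.card (edges L k A) : ℝ) ^ Nat.card π.Outer) := by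
  rw [profileProb, card_hasProfile hroots, card_isRep, Nat.card_fun, Nat.card_fun, Nat.card_fin,
    Nat.card_congr (vertexEquiv (A := A) hroots), Nat.card_sum, Nat.card_prod,
    internalProportion_eq hroots]
  have hA : (0 : ℝ) < Nat.card A := by exact_mod_cast Nat.card_pos
  have hp := card_internal_add_card_outer π
  have hblock := π.card_block_le
  have hb0 : Nat.card π.Block = 0 → Nat.card π.Outer = 0 := by
    intro h
    rw [Finite.card_eq_zero_iff] at h ⊢
    exact ⟨fun i => h.elim (blockOf i)⟩
  generalize Nat.card A = a at *
  generalize Nat.card (edges L k A) = N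
  generalize Nat.card (NonRoot L k G) = g
  generalize Nat.card {i // i ∈ π.I} = i at *
  generalize Nat.card π.Outer = s at *
  generalize Nat.card π.Block = t at *
  subst hp
  have hM : (0 : ℝ) < a + N * g := by positivity
  have h1 : 1 - (a : ℝ) / (a + N * g) = N * g / (a + N * g) := by
    field_simp
    ring
  rw [h1]
  push_cast
  -- Without edges, either there are no blocks and hence no external indices, or both sides vanish
  -- because the falling factorial does.
  rcases Nat.eq_zero_or_pos N with rfl | hN
  · rcases Nat.eq_zero_or_pos t with rfl | ht
    · obtain rfl := hb0 rfl
      simp [div_pow]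
    · obtain ⟨t, rfl⟩ : ∃ t', t = t' + 1 := ⟨t - 1, by omega⟩
      simp
  · have hN : (0 : ℝ) < N := by exact_mod_cast hN
    rw [div_pow, div_pow, mul_pow, pow_add]
    field_simp

end Counting

/-! ### Limits of profile probabilities -/

section ProfileLimit

variable {L : FirstOrder.Language.{v, w}} {k p : ℕ} {A G : ℕ → Type u}
  [∀ n, (baseLang L k).Structure (A n)] [∀ n, (gadgetLang L k).Structure (G n)]

open Profile

/-- Convergence of the number of edges is needed only for `p ≥ 2` and `c < 1`. A single external
vertex involves no coincidences, and for `c = 1` any external index forces the limit `0`. -/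
theorem converges_profileProb [∀ n, Finite (A n)] [∀ n, Nonempty (A n)] [∀ n, Finite (G n)]
    (hroots : ∀ n, Function.Injective (root L k (G n))) {c : ℝ}
    (h_int : Tendsto (fun n => internalProportion L k (A n) (G n)) atTop (𝓝 c))
    (h_edges : 2 ≤ p → c < 1 → (∃ r : ℕ, ∀ᶠ n in atTop, Nat.card (edges L k (A n)) = r) ∨
      Tendsto (fun n => Nat.card (edges L k (A n))) atTop atTop) (π : Profile p) :
    Converges fun n => profileProb L k π (A n) (G n) := by
  simp only [fun n => profileProb_eq (A := A n) (hroots n) π]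
  have hts := π.card_block_le
  have hp := card_internal_add_card_outer π
  have hb0 : Nat.card π.Block = 0 → Nat.card π.Outer = 0 := by
    intro h
    rw [Finite.card_eq_zero_iff] at h ⊢
    exact ⟨fun i => h.elim (blockOf i)⟩
  have hle : ∀ n, internalProportion L k (A n) (G n) ≤ 1 := by
    intro n
    rw [internalProportion_eq (hroots n)]
    exact div_le_one_of_le₀ (le_add_of_nonneg_right (by positivity)) (by positivity)
  have hext : Converges fun n => (1 - internalProportion L k (A n) (G n)) ^ Nat.card π.Outer :=
    ⟨_, (tendsto_const_nhds.sub h_int).pow _⟩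
  have hint : Converges fun n => internalProportion L k (A n) (G n) ^ Nat.card {i // i ∈ π.I} :=
    ⟨_, h_int.pow _⟩
  simp only [mul_assoc]
  refine hint.mul ?_
  rcases Nat.eq_zero_or_pos (Nat.card π.Outer) with hs | hs
  · rw [hs] at hts ⊢
    have ht : Nat.card π.Block = 0 := by omega
    simp only [ht, Nat.descFactorial_zero, pow_zero, Nat.cast_one, div_one, mul_one]
    exact Converges.const 1
  · rcases lt_or_ge c 1 with hc | hc
    · by_cases h2 : 2 ≤ p
      · exact hext.mul (converges_descFactorial_div_pow hts (h_edges h2 hc))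
      · have hs1 : Nat.card π.Outer = 1 := by omega
        have ht1 : Nat.card π.Block = 1 := by
          by_contra h
          exact absurd (hb0 (by omega)) (by omega)
        rw [hs1] at hext
        rw [hs1, ht1]
        obtain ⟨l, hl⟩ := hext
        refine ⟨l, hl.congr fun n => ?_⟩
        -- The factor `N / N` is `0` rather than `1` for `N = 0`, but then no vertex is external and
        -- the other factor is already `0`.
        rcases Nat.eq_zero_or_pos (Nat.card (edges L k (A n))) with hN | hN
        · have hA : (Nat.card (A n) : ℝ) ≠ 0 := by exact_mod_cast Nat.card_pos.ne'
          rw [internalProportion_eq (hroots n), hN]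
          simp [hA]
        · have hN : (Nat.card (edges L k (A n)) : ℝ) ≠ 0 := by exact_mod_cast hN.ne'
          rw [Nat.descFactorial_one, pow_one, pow_one, div_self hN, mul_one]
    · obtain rfl : c = 1 := le_antisymm (le_of_tendsto' h_int hle) hc
      have h0 : Tendsto (fun n => (1 - internalProportion L k (A n) (G n)) ^ Nat.card π.Outer)
          atTop (𝓝 0) := by
        have := ((tendsto_const_nhds (x := (1 : ℝ))).sub h_int).pow (Nat.card π.Outer)
        rwa [sub_self, zero_pow hs.ne'] at this
      refine ⟨0, squeeze_zero (fun n => ?_) (fun n => ?_) h0⟩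
      · have := sub_nonneg.2 (hle n)
        positivity
      · exact mul_le_of_le_one_right (pow_nonneg (sub_nonneg.2 (hle n)) _)
          (descFactorial_div_pow_le_one hts _)

/-- Every block size of a non-trivial profile is at most the maximal size of a first block. -/
theorem card_block_le_of_isGreatest {m : ℕ}
    (hm : IsGreatest {s : ℕ | ∃ π : Profile p,
      ¬ IsTrivialProfile L k π A G ∧ s = π.firstBlockCard} m)
    {π : Profile p} (hπ : ¬ IsTrivialProfile L k π A G) (E : π.Block) : Nat.card {i // i ∈ E.1} ≤ m := by
  classical
  have hne : (π.I)ᶜ.Nonempty := ⟨(blockRep E).1, Finset.mem_compl.2 (blockRep E).2⟩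
  set i := (π.I)ᶜ.min' hne
  have hiI : i ∉ π.I := Finset.mem_compl.1 (Finset.min'_mem _ hne)
  set j := (blockRep E).1
  have hjI : j ∉ π.I := (blockRep E).2
  -- Swapping the least external index `i` with a member `j` of `E` turns `E` into the first block
  -- of a profile `π'` with the same probability, which is therefore also non-trivial.
  let σ : Equiv.Perm (Fin p) := _root_.Equiv.swap i j
  have hσI : ∀ l, σ l ∈ π.I ↔ l ∈ π.I := by
    intro l
    by_cases h1 : l = i
    · subst h1
      simp only [σ, _root_.Equiv.swap_apply_left]
      exact iff_of_false hjI hiI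
    · by_cases h2 : l = j
      · rw [h2]
        simp only [σ, _root_.Equiv.swap_apply_right]
        exact iff_of_false hiI hjI
      · simp only [σ, _root_.Equiv.swap_apply_of_ne_of_ne h1 h2]
  let π' : Profile p := Profile.ofSetoid π.I (Setoid.ker fun l => π.blocks.part (σ l))
  have hsame : ∀ l l', l ∉ π.I → l' ∉ π.I → (π'.SameBlock l l' ↔ π.SameBlock (σ l) (σ l')) := by
    intro l l' hl hl'
    rw [sameBlock_iff_part_eq ((hσI l).not.2 hl) ((hσI l').not.2 hl')]
    exact Profile.ofSetoid_sameBlock_iff hl hl'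
  have hprof : ∀ n (a : Fin p → GadgetProd L k (A n) (G n)),
      HasProfile L k π' (a ∘ σ) ↔ HasProfile L k π a := by
    intro n a
    constructor
    · rintro ⟨h1, h2⟩
      refine ⟨fun l => ?_, fun l l' hl hl' => ?_⟩
      · have := h1 (σ.symm l)
        have e : σ.symm l ∈ π.I ↔ l ∈ π.I := by rw [← hσI, _root_.Equiv.apply_symm_apply]
        simp only [Function.comp, _root_.Equiv.apply_symm_apply] at this
        exact e.symm.trans this
      · have e1 : σ.symm l ∉ π.I := by rwa [← hσI, _root_.Equiv.apply_symm_apply]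
        have e2 : σ.symm l' ∉ π.I := by rwa [← hσI, _root_.Equiv.apply_symm_apply]
        have := h2 (σ.symm l) (σ.symm l') e1 e2
        rw [hsame _ _ e1 e2] at this
        simpa only [Function.comp, _root_.Equiv.apply_symm_apply] using this
    · rintro ⟨h1, h2⟩
      refine ⟨fun l => ?_, fun l l' hl hl' => ?_⟩
      · exact (hσI l).symm.trans (h1 (σ l))
      · rw [hsame _ _ hl hl']
        exact h2 _ _ ((hσI l).not.2 hl) ((hσI l').not.2 hl')
  have hπ' : ¬ IsTrivialProfile L k π' A G := by
    refine fun h => hπ (h.congr fun n => ?_)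
    have : Nat.card {a : Fin p → GadgetProd L k (A n) (G n) // HasProfile L k π' a} =
        Nat.card {a : Fin p → GadgetProd L k (A n) (G n) // HasProfile L k π a} :=
      (Nat.card_congr ((_root_.Equiv.arrowCongr σ.symm (_root_.Equiv.refl _)).subtypeEquiv
        fun a => (hprof n a).symm)).symm
    rw [profileProb, profileProb, this]
  refine le_trans (le_of_eq ?_) (hm.2 ⟨π', hπ', rfl⟩)
  rw [Profile.firstBlockCard, dif_pos (by exact hne)]
  have : π'.blocks.part i = E.1.map σ.toEmbedding := by
    ext l
    rw [Finset.mem_map_equiv, ← sameBlock_iff_mem_part]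
    have hσσ : σ.symm l = σ l := by simp [σ]
    rw [hσσ]
    by_cases hl : l ∈ π.I
    · refine iff_of_false ?_ fun h => notMem_of_mem_block E h ((hσI l).2 hl)
      rintro ⟨E', hE', -, h⟩
      exact notMem_of_mem_block (π := π') ⟨E', hE'⟩ h hl
    · rw [hsame i l hiI hl]
      have : σ i = j := _root_.Equiv.swap_apply_left i j
      rw [this]
      exact sameBlock_iff_mem (blockRep_mem E)
  have h2 : (π'.blocks.part ((π'.I)ᶜ.min' hne)) = E.1.map σ.toEmbedding := this
  rw [h2, Finset.card_map]
  simp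

end ProfileLimit

/-! ### Limits of densities of types in gadgets -/

section GadgetLimit

variable {L : FirstOrder.Language.{v, w}} {k : ℕ} {G : ℕ → Type u}
  [∀ n, (gadgetLang L k).Structure (G n)] (S : Set (Σ n, L.Relations n)) (r q : ℕ)

theorem nonempty_gadget (L : FirstOrder.Language.{v, w}) {k : ℕ} (hk : 0 < k) (G : Type u)
    [(gadgetLang L k).Structure G] : Nonempty G := ⟨root L k G ⟨0, hk⟩⟩

/-- The roots are part of the typed tuple, so its atomic type records which entries are roots. -/
theorem nonRoot_of_copyType_eq {α : Type} {n n' : ℕ} {x : α → G n} {x' : α → G n'}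
    (h : copyType k S r q x = copyType k S r q x') (hx : ∀ i, x i ∉ Set.range (root L k (G n))) (i : α) :
    x' i ∉ Set.range (root L k (G n')) := by
  rintro ⟨s, hs⟩
  have := (rankType_zero_iff.1 (rankType_of_le (Nat.zero_le q) h)).1 (Sum.inl s) (Sum.inr i)
  exact hx i ⟨s, this.2 hs⟩

variable [∀ n, Finite (G n)] [Finite S]

/-- The type is expressed in `m` variables; the surplus ones are dummies, which cancel from the
density. -/
theorem converges_copyType (hk : 0 < k) {m : ℕ} (h : CLocConvergent (gadgetLang L k) m G)
    {α : Type} [Finite α] (hα : Nat.card α ≤ m) (θ : RankType (gadgetSymbols k S) q (Fin k ⊕ α)) :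
    Converges fun n => (Nat.card {x : α → G n // copyType k S r q x = θ} : ℝ) /
      Nat.card (α → G n) := by
  have e : α ⊕ Fin (m - Nat.card α) ≃ Fin m := by
    refine (Finite.equivFinOfCardEq ?_)
    rw [Nat.card_sum, Nat.card_fin]
    omega
  obtain ⟨φ, hφ, hφ'⟩ := exists_isConstLocal_rankType (gadgetSymbols k S) (e ∘ Sum.inl) r q θ
  obtain ⟨l, hl⟩ := h φ hφ
  refine ⟨l, hl.congr fun n => ?_⟩
  have : Nonempty (G n) := nonempty_gadget L hk (G n)
  let f : (Fin m → G n) ≃ (α → G n) × (Fin (m - Nat.card α) → G n) :=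
    (_root_.Equiv.arrowCongr e.symm (_root_.Equiv.refl _)).trans
      (_root_.Equiv.sumArrowEquivProdArrow _ _ _)
  have h1 : Nat.card {x : Fin m → G n // φ.Realize x} =
      Nat.card {x : α → G n // copyType k S r q x = θ} *
        Nat.card (Fin (m - Nat.card α) → G n) := by
    rw [← Nat.card_prod]
    refine Nat.card_congr ((f.subtypeEquiv (q := fun y => copyType k S r q y.1 = θ)
      fun x => hφ' (G n) x).trans ?_)
    exact
      { toFun := fun y => (⟨y.1.1, y.2⟩, y.1.2)
        invFun := fun y => ⟨(y.1.1, y.2), y.1.2⟩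
        left_inv := fun _ => rfl
        right_inv := fun _ => rfl }
  have h2 : Nat.card (Fin m → G n) = Nat.card (α → G n) * Nat.card (Fin (m - Nat.card α) → G n) := by
    rw [← Nat.card_prod]
    exact Nat.card_congr f
  have h3 : (Nat.card (Fin (m - Nat.card α) → G n) : ℝ) ≠ 0 := by
    exact_mod_cast Nat.card_pos.ne'
  rw [stonePairing, h1, h2]
  push_cast
  rw [mul_div_mul_right _ _ h3]

/-- The densities of properties of tuples that are determined by types converge. -/
theorem converges_of_copyType (hk : 0 < k) {m : ℕ} (h : CLocConvergent (gadgetLang L k) m G)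
    {α : Type} [Finite α] (hα : Nat.card α ≤ m) (P : ∀ n, (α → G n) → Prop)
    (hP : ∀ n n' (x : α → G n) (x' : α → G n'), copyType k S r q x = copyType k S r q x' →
      P n x → P n' x') :
    Converges fun n => (Nat.card {x : α → G n // P n x} : ℝ) / Nat.card (α → G n) := by
  have := Fintype.ofFinite (RankType (gadgetSymbols k S) q (Fin k ⊕ α))
  have key : ∀ n, (Nat.card {x : α → G n // P n x} : ℝ) / Nat.card (α → G n) =
      ∑ θ : RankType (gadgetSymbols k S) q (Fin k ⊕ α),
        (Nat.card {x : α → G n // copyType k S r q x = θ ∧ P n x} : ℝ) / Nat.card (α → G n) := by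
    intro n
    rw [card_subtype_eq_sum (P n) (fun θ x => copyType k S r q x = θ)
      (fun x => ⟨_, rfl, fun _ h => h.symm⟩), Nat.cast_sum, Finset.sum_div]
  simp only [key]
  refine Converges.sum fun θ => ?_
  -- By `hP` a type implies the property in all gadgets of the sequence or in none. The summand is
  -- thus the full density of the type, or zero for every `n`.
  by_cases hθ : ∃ n, ∃ x : α → G n, copyType k S r q x = θ ∧ P n x
  · obtain ⟨n₀, x₀, h1, h2⟩ := hθ
    have : ∀ n (x : α → G n), copyType k S r q x = θ ∧ P n x ↔ copyType k S r q x = θ :=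
      fun n x => and_iff_left_of_imp fun h => hP n₀ n x₀ x (h1.trans h.symm) h2
    simp only [this]
    exact converges_copyType S r q hk h hα θ
  · have : ∀ n (x : α → G n), ¬ (copyType k S r q x = θ ∧ P n x) := fun n x h => hθ ⟨n, x, h⟩
    simp only [this]
    simpa using Converges.const 0

/-- The conditional density is the density of root-avoiding tuples of the given type divided by a
power of the proportion of non-roots, whose limit has to be positive. -/
theorem converges_nonRoot_copyType (hk : 0 < k) (hroots : ∀ n, Function.Injective (root L k (G n)))
    {m : ℕ} (h : CLocConvergent (gadgetLang L k) m G) (hpos : ∃ᶠ n in atTop, Nonempty (NonRoot L k (G n)))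
    {α : Type} [Finite α] [Nonempty α] (hα : Nat.card α ≤ m)
    (θ : RankType (gadgetSymbols k S) q (Fin k ⊕ α)) :
    Converges fun n => (Nat.card {x : α → NonRoot L k (G n) //
      copyType k S r q (fun i => (x i).1) = θ} : ℝ) / Nat.card (α → NonRoot L k (G n)) := by
  have hα0 : 0 < Nat.card α := Nat.card_pos
  obtain ⟨d, hd⟩ : Converges fun n => (Nat.card (NonRoot L k (G n)) : ℝ) / Nat.card (G n) := by
    obtain ⟨l, hl⟩ := converges_of_copyType S r q hk h (α := Unit) (by simp; omega)
      (fun n x => ∀ i, x i ∉ Set.range (root L k (G n)))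
      (fun n n' x x' e hx => nonRoot_of_copyType_eq S r q e hx)
    refine ⟨l, hl.congr fun n => ?_⟩
    congr 2
    · exact Nat.card_congr ((_root_.Equiv.funUnique Unit (G n)).subtypeEquiv fun x =>
        ⟨fun h => h (), fun h _ => h⟩)
    · exact Nat.card_congr (_root_.Equiv.funUnique Unit (G n))
  -- With `g ≥ 1` non-roots the proportion is `g / (g + k) ≥ 1 / (k + 1)`. This happens infinitely
  -- often, so the bound passes to the limit.
  have hd0 : (1 : ℝ) / (k + 1) ≤ d := by
    refine isClosed_Ici.mem_of_frequently_of_tendsto (hpos.mono fun n hn => ?_) hd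
    have h1 : 1 ≤ Nat.card (NonRoot L k (G n)) := Nat.card_pos
    have h1 : (1 : ℝ) ≤ Nat.card (NonRoot L k (G n)) := by exact_mod_cast h1
    rw [Set.mem_Ici, ← card_nonRoot_add (hroots n)]
    push_cast
    rw [div_le_div_iff₀ (by positivity) (by positivity)]
    nlinarith [(Nat.cast_nonneg k : (0 : ℝ) ≤ k)]
  have hd0 : d ≠ 0 := ne_of_gt (lt_of_lt_of_le (by positivity) hd0)
  have hinv : Converges fun n =>
      (((Nat.card (NonRoot L k (G n)) : ℝ) / Nat.card (G n)) ^ Nat.card α)⁻¹ :=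
    ⟨_, (hd.pow _).inv₀ (pow_ne_zero _ hd0)⟩
  have hmain := converges_of_copyType S r q hk h hα
    (fun n x => (∀ i, x i ∉ Set.range (root L k (G n))) ∧ copyType k S r q x = θ)
    (fun n n' x x' e hx => ⟨nonRoot_of_copyType_eq S r q e hx.1, e ▸ hx.2⟩)
  obtain ⟨l, hl⟩ := hmain.mul hinv
  refine ⟨l, hl.congr fun n => ?_⟩
  have e : {x : α → G n // (∀ i, x i ∉ Set.range (root L k (G n))) ∧ copyType k S r q x = θ} ≃
      {x : α → NonRoot L k (G n) // copyType k S r q (fun i => (x i).1) = θ} :=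
    { toFun := fun x => ⟨fun i => ⟨x.1 i, x.2.1 i⟩, x.2.2⟩
      invFun := fun x => ⟨fun i => (x.1 i).1, fun i => (x.1 i).2, x.2⟩
      left_inv := fun _ => rfl
      right_inv := fun _ => rfl }
  have : Nonempty (G n) := nonempty_gadget L hk (G n)
  have hG : (Nat.card (G n) : ℝ) ≠ 0 := by exact_mod_cast Nat.card_pos.ne'
  rw [Nat.card_congr e, Nat.card_fun, Nat.card_fun]
  push_cast
  rw [div_pow, inv_div, div_mul_div_comm, mul_comm ((Nat.card (G n) : ℝ) ^ _),
    mul_div_mul_right _ _ (pow_ne_zero _ hG)]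

end GadgetLimit

/-! ### The main theorem -/

section Main

variable {L : FirstOrder.Language.{v, w}} {k p : ℕ} {A G : ℕ → Type u}
  [∀ n, (baseLang L k).Structure (A n)] [∀ n, (gadgetLang L k).Structure (G n)]

open Profile

/-- By independence, a combination of types has density equal to the profile probability, times the
conditional base density, times the block densities, times the indicator that the roots have the
required type. -/
theorem converges_profile_part [L.IsRelational] [IsEmpty (L.Relations 0)] (hk : 0 < k)
    [∀ n, Finite (A n)] [∀ n, Finite (G n)]
    (hroots : ∀ n, Function.Injective (root L k (G n))) {π : Profile p}
    (hprob : Converges fun n => profileProb L k π (A n) (G n))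
    (hbase : ∀ φ : (baseLang L k).Formula (RepVar k π), IsLocal.{u} φ →
      Converges fun n => condStonePairing L k π φ (A n))
    {m : ℕ} (hm : ∀ E : π.Block, Nat.card {i // i ∈ E.1} ≤ m)
    (hpos : Nonempty π.Block → ∃ᶠ n in atTop, Nonempty (NonRoot L k (G n)))
    (h_gadget : CLocConvergent (gadgetLang L k) m G) {φ : L.Formula (Fin p)} (hφ : IsLocal.{u} φ) :
    Converges fun n => (Nat.card {a : Fin p → GadgetProd L k (A n) (G n) //
      HasProfile L k π a ∧ φ.Realize a} : ℝ) / Nat.card (Fin p → GadgetProd L k (A n) (G n)) := by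
  obtain ⟨r, hφ⟩ := hφ
  obtain ⟨S, q, hS, hq⟩ := exists_rankType_formula_realize.{u} φ
  have : Finite S := hS
  set Q := q * (k + 1) + k
  let X : ℕ → Type u := fun n =>
    {b : RepVar k π → A n // IsRep L k π b} × (π.Outer → NonRoot L k (G n))
  let Data : Type w := RankType (baseSymbols k S) Q (RepVar k π) ×
    (∀ E : π.Block, RankType (gadgetSymbols k S) Q (Fin k ⊕ {i // i ∈ E.1})) ×
    RankType (gadgetSymbols k S) Q (Fin k ⊕ Empty)
  have := Fintype.ofFinite Data
  -- The last component depends on the gadget only: it is the type of the roots, needed for the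
  -- copies on edges outside the representation.
  let data : ∀ n, X n → Data := fun n bx => (baseType k S (r + 1) Q bx.1.1,
    fun E => copyType k S (r + 1) Q (fun i => (bx.2 (blockIncl E i)).1),
    copyType k S (r + 1) Q (Empty.elim : Empty → G n))
  let holds : ∀ n, X n → Prop := fun n bx => φ.Realize (profileTuple bx.1.2 fun i => (bx.2 i).1)
  have hdata : ∀ n n' (y : X n) (y' : X n'), data n y = data n' y' → holds n y → holds n' y' := by
    intro n n' y y' e h
    obtain ⟨h1, h2⟩ := Prod.ext_iff.1 e
    obtain ⟨h2, h3⟩ := Prod.ext_iff.1 h2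
    exact (realize_profileTuple_iff hk (hroots n) (hroots n') hφ hq y.1.2 y'.1.2
      (fun i => (y.2 i).2) (fun i => (y'.2 i).2) h1 (fun E => congrFun h2 E) h3).1 h
  have hcount : ∀ n, Nat.card {a : Fin p → GadgetProd L k (A n) (G n) //
      HasProfile L k π a ∧ φ.Realize a} = Nat.card {y : X n // holds n y} := by
    intro n
    exact Nat.card_congr (((profileEquiv (hroots n) π).subtypeEquiv (fun y => Iff.rfl)).trans
      (_root_.Equiv.subtypeSubtypeEquivSubtypeInter _ _)).symm
  have key : ∀ n, (Nat.card {a : Fin p → GadgetProd L k (A n) (G n) //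
      HasProfile L k π a ∧ φ.Realize a} : ℝ) / Nat.card (Fin p → GadgetProd L k (A n) (G n)) =
      ∑ d : Data, (Nat.card {y : X n // data n y = d ∧ holds n y} : ℝ) /
        Nat.card (Fin p → GadgetProd L k (A n) (G n)) := by
    intro n
    rw [hcount, card_subtype_eq_sum (holds n) (fun d y => data n y = d)
      (fun x => ⟨_, rfl, fun _ h => h.symm⟩), Nat.cast_sum, Finset.sum_div]
  simp only [key]
  refine Converges.sum fun d => ?_
  -- The data decide the formula uniformly in `n`, so each summand is zero for every `n` or the
  -- density of its data.
  by_cases hd : ∃ n, ∃ y : X n, data n y = d ∧ holds n y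
  swap
  · have : ∀ n (y : X n), ¬ (data n y = d ∧ holds n y) := fun n y h => hd ⟨n, y, h⟩
    simp only [this]
    simpa using Converges.const 0
  obtain ⟨n₀, y₀, h1, h2⟩ := hd
  have hiff : ∀ n (y : X n), data n y = d ∧ holds n y ↔ data n y = d :=
    fun n x => and_iff_left_of_imp fun h => hdata n₀ n y₀ x (h1.trans h.symm) h2
  simp only [hiff]
  obtain ⟨τ, θ, θ₀⟩ := d
  obtain ⟨ψ, hψ, hψ'⟩ := exists_isLocal_rankType.{u} (baseSymbols k S) (r + 1) Q τ
  have hcond := hbase ψ hψ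
  have hcopy : Converges fun n => ∏ E : π.Block,
      (Nat.card {x : {i // i ∈ E.1} → NonRoot L k (G n) //
        copyType k S (r + 1) Q (fun i => (x i).1) = θ E} : ℝ) /
        Nat.card ({i // i ∈ E.1} → NonRoot L k (G n)) := by
    refine Converges.prod fun E => ?_
    have : Nonempty {i // i ∈ E.1} := ⟨⟨_, blockRep_mem E⟩⟩
    exact converges_nonRoot_copyType S (r + 1) Q hk hroots h_gadget (hpos ⟨E⟩) (hm E) (θ E)
  -- There is one empty tuple, so this density is `0` or `1`; its convergence says that eventually
  -- the roots always or never have the type `θ₀`.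
  have hrest := converges_copyType S (r + 1) Q hk h_gadget (α := Empty) (by simp) θ₀
  obtain ⟨l, hl⟩ := ((hprob.mul hcond).mul hcopy).mul hrest
  refine ⟨l, hl.congr fun n => ?_⟩
  have e : {y : X n // data n y = (τ, θ, θ₀)} ≃
      ({b : RepVar k π → A n // IsRep L k π b ∧ ψ.Realize b} ×
        (∀ E : π.Block, {x : {i // i ∈ E.1} → NonRoot L k (G n) //
          copyType k S (r + 1) Q (fun i => (x i).1) = θ E})) ×
        {x : Empty → G n // copyType k S (r + 1) Q x = θ₀} := by
    have e1 := outerFunEquiv (π := π) (X := NonRoot L k (G n)) fun E x =>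
      copyType k S (r + 1) Q (fun i => (x i).1) = θ E
    refine _root_.Equiv.trans ?_ (_root_.Equiv.prodCongr
      (_root_.Equiv.prodCongr (_root_.Equiv.refl _) e1) (_root_.Equiv.refl _))
    have h0 : ∀ x : Empty → G n, x = Empty.elim := fun x => Subsingleton.elim _ _
    exact
      { toFun := fun y => ((⟨y.1.1.1, y.1.1.2, (hψ' _ _).2 (congrArg Prod.fst y.2)⟩,
          ⟨y.1.2, fun E => congrFun (congrArg (fun d => d.2.1) y.2) E⟩),
          ⟨Empty.elim, congrArg (fun d => d.2.2) y.2⟩)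
        invFun := fun y => ⟨(⟨y.1.1.1, y.1.1.2.1⟩, y.1.2.1), Prod.ext ((hψ' _ _).1 y.1.1.2.2)
          (Prod.ext (funext y.1.2.2)
          ((congrArg _ (h0 y.2.1)).symm.trans y.2.2))⟩
        left_inv := fun _ => rfl
        right_inv := fun y => Prod.ext rfl (Subtype.ext (h0 _).symm) }
  have e2 : Nat.card (π.Outer → NonRoot L k (G n)) =
      ∏ E : π.Block, Nat.card ({i // i ∈ E.1} → NonRoot L k (G n)) := by
    rw [← Nat.card_pi]
    refine Nat.card_congr (_root_.Equiv.trans ?_ ((outerFunEquiv (π := π)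
      (X := NonRoot L k (G n)) fun _ _ => True).trans ?_))
    · exact (_root_.Equiv.subtypeUnivEquiv fun _ _ => trivial).symm
    · exact _root_.Equiv.piCongrRight fun E => _root_.Equiv.subtypeUnivEquiv fun _ => trivial
  have h0 : Nat.card (Empty → G n) = 1 := by simp
  have e3 : Nat.card (∀ E : π.Block, {x : {i // i ∈ E.1} → NonRoot L k (G n) //
      copyType k S (r + 1) Q (fun i => (x i).1) = θ E}) = _ := Nat.card_pi
  rw [Nat.card_congr e, Nat.card_prod, Nat.card_prod, e3, profileProb,
    card_hasProfile (hroots n), e2, condStonePairing, Finset.prod_div_distrib, h0]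
  push_cast
  -- The conditional densities may have the form `0 / 0`. When a denominator vanishes so does its
  -- numerator, and the product formula persists.
  have z1 : (Nat.card {b : RepVar k π → A n // IsRep L k π b} : ℝ) = 0 →
      (Nat.card {b : RepVar k π → A n // IsRep L k π b ∧ ψ.Realize b} : ℝ) = 0 := by
    intro h
    have h : Nat.card {b : RepVar k π → A n // IsRep L k π b} = 0 := by exact_mod_cast h
    rw [Finite.card_eq_zero_iff] at h
    have : IsEmpty {b : RepVar k π → A n // IsRep L k π b ∧ ψ.Realize b} :=
      ⟨fun b => h.elim ⟨b.1, b.2.1⟩⟩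
    simp
  have z2 : (∏ E : π.Block, (Nat.card ({i // i ∈ E.1} → NonRoot L k (G n)) : ℝ)) = 0 →
      (∏ E : π.Block, (Nat.card {x : {i // i ∈ E.1} → NonRoot L k (G n) //
        copyType k S (r + 1) Q (fun i => (x i).1) = θ E} : ℝ)) = 0 := by
    intro h
    obtain ⟨E, -, hE⟩ := Finset.prod_eq_zero_iff.1 h
    refine Finset.prod_eq_zero (Finset.mem_univ E) ?_
    have hE : Nat.card ({i // i ∈ E.1} → NonRoot L k (G n)) = 0 := by exact_mod_cast hE
    rw [Finite.card_eq_zero_iff] at hE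
    have : IsEmpty {x : {i // i ∈ E.1} → NonRoot L k (G n) //
        copyType k S (r + 1) Q (fun i => (x i).1) = θ E} := ⟨fun x => hE.elim x.1⟩
    simp
  rw [div_one]
  have aux : ∀ a a' b b' c c' : ℝ, (a = 0 → a' = 0) → (b = 0 → b' = 0) →
      a * b / c' * (a' / a) * (b' / b) * c = a' * b' * c / c' := by
    intro a a' b b' c c' ha hb
    by_cases ha0 : a = 0
    · simp [ha0, ha ha0]
    · by_cases hb0 : b = 0
      · simp [hb0, hb hb0]
      · by_cases hc : c' = 0
        · simp [hc]
        · field_simp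
  exact aux _ _ _ _ _ _ z1 z2

end Main

end GadgetLim

end

theorem mainTheorem5 (L : FirstOrder.Language.{v, w}) [L.IsRelational] [IsEmpty (L.Relations 0)]
    (k : ℕ) (hk : 1 ≤ k) (p : ℕ) (hp : 1 ≤ p)
    (A G : ℕ → Type u)
    [∀ n, (GadgetLim.baseLang L k).Structure (A n)]
    [∀ n, (GadgetLim.gadgetLang L k).Structure (G n)]
    [∀ n, Finite (A n)] [∀ n, Nonempty (A n)] [∀ n, Finite (G n)]
    (hroots : ∀ n, Function.Injective (GadgetLim.root L k (G n)))
    (h_base : ∀ π : GadgetLim.Profile p, ¬ GadgetLim.IsTrivialProfile L k π A G →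
      ∀ φ : (GadgetLim.baseLang L k).Formula (GadgetLim.RepVar k π), GadgetLim.IsLocal.{u} φ →
        GadgetLim.Converges fun n => GadgetLim.condStonePairing L k π φ (A n))
    (m : ℕ)
    (hm : IsGreatest {s : ℕ | ∃ π : GadgetLim.Profile p,
      ¬ GadgetLim.IsTrivialProfile L k π A G ∧ s = π.firstBlockCard} m)
    (h_gadget : GadgetLim.CLocConvergent (GadgetLim.gadgetLang L k) m G)
    (c : ℝ)
    (h_int : Tendsto (fun n => GadgetLim.internalProportion L k (A n) (G n)) atTop (𝓝 c))
    (h_edges : 2 ≤ p → c < 1 →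
      (∃ r : ℕ, ∀ᶠ n in atTop, Nat.card (GadgetLim.edges L k (A n)) = r) ∨
        Tendsto (fun n => Nat.card (GadgetLim.edges L k (A n))) atTop atTop) :
    GadgetLim.LocConvergent L p (fun n => GadgetLim.GadgetProd L k (A n) (G n)) := by
  intro φ hφ
  have := Fintype.ofFinite (GadgetLim.Profile p)
  have hfin : ∀ n, Finite (GadgetLim.GadgetProd L k (A n) (G n)) := fun n =>
    GadgetLim.finite_gadgetProd
  have key : ∀ n, GadgetLim.stonePairing φ (GadgetLim.GadgetProd L k (A n) (G n)) =
      ∑ π : GadgetLim.Profile p, (Nat.card {a : Fin p → GadgetLim.GadgetProd L k (A n) (G n) //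
        GadgetLim.HasProfile L k π a ∧ φ.Realize a} : ℝ) /
          Nat.card (Fin p → GadgetLim.GadgetProd L k (A n) (G n)) := by
    intro n
    rw [GadgetLim.stonePairing, GadgetLim.card_subtype_eq_sum _
      (fun π a => GadgetLim.HasProfile L k π a) (fun a => ?_), Nat.cast_sum, Finset.sum_div]
    obtain ⟨π, hπ⟩ := GadgetLim.exists_hasProfile (hroots n) a
    exact ⟨π, hπ, fun π' hπ' => hπ'.unique hπ⟩
  simp only [key]
  refine GadgetLim.Converges.sum fun π => ?_
  by_cases hπ : GadgetLim.IsTrivialProfile L k π A G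
  · refine ⟨0, squeeze_zero (fun n => by positivity) (fun n => ?_) hπ⟩
    refine div_le_div_of_nonneg_right ?_ (by positivity)
    exact_mod_cast Nat.card_le_card_of_injective
      (fun a : {a : Fin p → GadgetLim.GadgetProd L k (A n) (G n) //
        GadgetLim.HasProfile L k π a ∧ φ.Realize a} =>
        (⟨a.1, a.2.1⟩ : {a : Fin p → GadgetLim.GadgetProd L k (A n) (G n) //
          GadgetLim.HasProfile L k π a}))
      (fun _ _ h => Subtype.ext (Subtype.mk.inj h))
  · refine GadgetLim.converges_profile_part hk hroots
      (GadgetLim.converges_profileProb hroots h_int h_edges π) (h_base π hπ)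
      (GadgetLim.card_block_le_of_isGreatest hm hπ) ?_ h_gadget hφ
    -- If eventually no gadget had a non-root, there would be no external vertices, and a profile
    -- with a block would be trivial.
    rintro ⟨E⟩
    by_contra hcon
    rw [not_frequently] at hcon
    refine hπ (tendsto_const_nhds.congr' ?_)
    filter_upwards [hcon] with n hn
    have : IsEmpty (π.Outer → GadgetLim.NonRoot L k (G n)) :=
      ⟨fun x => hn ⟨x (GadgetLim.Profile.blockRep E)⟩⟩
    rw [GadgetLim.profileProb, GadgetLim.card_hasProfile (hroots n)]
    simp
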